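/- Consider the two-user Gaussian symmetric interference channel $y_1 = h_d x_1 + h_c x_2 + z_1$, $y_2 = h_d x_2 + h_c x_1 + z_2$, with real gains $h_d, h_c$, noises $z_1, z_2\sim\mathcal N(0,1)$ that are i.i.d. in time, independent of each other and of the transmitters, and power constraint $P \ge 0$. Put $\mathrm{SNR} = h_d^2P$ and $\mathrm{INR} = h_c^2P$. The transmitters cooperate over noiseless, secure links, one in each direction, each of rate $C_G \ge 0$ bits per channel use. A code of block length $N$ consists of independent messages $W_i$ ($i=1,2$), uniform on $\{1,\dots,M_i\}$; independent local randomness at the two transmitters; cooperative symbols $v_{ij,k}$ ($j\ne i$, $1\le k\le N$), each a function of $W_i$, the local randomness of transmitter $i$ and the symbols $v_{ji,l}$, $l<k$, with values in finite sets $\mathcal V_{ij,k}$ such that $\prod_{k=1}^N|\mathcal V_{ij,k}|\le 2^{NC_G}$; inputs $x_{i,k}$, each a function of $W_i$, the local randomness of transmitter $i$ and the symbols $v_{ji,l}$, $l\le k$, with $\frac1N\sum_{k=1}^N E[x_{i,k}^2]\le P$; and decoders giving $\hat W_i$ as a function of $y_i^N$. A real number $R$ is an achievable symmetric secrecy rate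 if for every $\varepsilon>0$ and all sufficiently large $N$ there is such a code with $\frac1N\log_2 M_i\ge R-\varepsilon$, $\Pr[\hat W_i\ne W_i]\le\varepsilon$ and $\frac1N I(W_i;y_j^N)\le\varepsilon$ for $i = 1,2$ and $j\neq i$ (weak secrecy). Then every achievable symmetric secrecy rate $R_s$ satisfies $$R_s \le \max_{|\rho|\le 1}\left[2C_G+\tfrac12\log_2\left(1+\frac{\mathrm{SNR}+\mathrm{SNR}^2(1-\rho^2)}{1+\mathrm{SNR}+\mathrm{INR}+2\rho\sqrt{\mathrm{SNR}\cdot\mathrm{INR}}}\right)\right].$$ -/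

import Mathlib

open MeasureTheory ProbabilityTheory Filter

/-- The mutual information `I(X; Y)` (in nats) of two random variables on `(Ω, μ)`: the
Kullback-Leibler divergence of the joint law from the product of the marginal laws. -/
noncomputable def mutualInfo {Ω α β : Type*} [MeasurableSpace Ω] [MeasurableSpace α]
    [MeasurableSpace β] (μ : Measure Ω) (X : Ω → α) (Y : Ω → β) : ENNReal :=
  InformationTheory.klDiv (μ.map (fun ω => (X ω, Y ω))) ((μ.map X).prod (μ.map Y))

/-- A code of block length `N` for the two-user interference channel with cooperating
transmitters. The users are indexed by `Fin 2`, and `i.rev` is the other user. -/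
structure ICCode (N : ℕ) where
  /-- number of messages of user `i` -/
  numMsg : Fin 2 → ℕ
  numMsg_pos : ∀ i, 0 < numMsg i
  /-- alphabet of the local randomness of transmitter `i` -/
  Rand : Fin 2 → Type
  [measRand : ∀ i, MeasurableSpace (Rand i)]
  /-- law of the local randomness of transmitter `i` -/
  randLaw : ∀ i, Measure (Rand i)
  [probRand : ∀ i, IsProbabilityMeasure (randLaw i)]
  /-- size of the alphabet of the symbol that transmitter `i` sends over its cooperative link
  at time `k` -/
  coopCard : Fin 2 → Fin N → ℕ
  /-- the cooperative symbol of transmitter `i` at time `k`, as a function of its message, its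
  local randomness and the cooperative symbols received strictly before time `k` -/
  coop : ∀ (i : Fin 2) (k : Fin N), Fin (numMsg i) → Rand i →
    (∀ l : {l : Fin N // l < k}, Fin (coopCard i.rev l.1)) → Fin (coopCard i k)
  measurable_coop : ∀ i k w h, Measurable (fun r => coop i k w r h)
  /-- the channel input of transmitter `i` at time `k`, as a function of its message, its local
  randomness and the cooperative symbols received up to time `k` -/
  enc : ∀ (i : Fin 2) (k : Fin N), Fin (numMsg i) → Rand i →
    (∀ l : {l : Fin N // l ≤ k}, Fin (coopCard i.rev l.1)) → ℝ
  measurable_enc : ∀ i k w h, Measurable (fun r => enc i k w r h)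
  /-- the decoder of receiver `i` -/
  dec : ∀ i : Fin 2, (Fin N → ℝ) → Fin (numMsg i)
  measurable_dec : ∀ i, Measurable (dec i)

namespace ICCode

attribute [instance] ICCode.measRand ICCode.probRand

variable {N : ℕ} (c : ICCode N)

/-- The sample space: messages, local randomness of the transmitters, receiver noises. -/
abbrev Sample : Type :=
  (∀ i : Fin 2, Fin (c.numMsg i)) × (∀ i : Fin 2, c.Rand i) × (Fin 2 → Fin N → ℝ)

/-- Uniform messages, local randomness and standard Gaussian noises, all independent. -/
noncomputable def prob : Measure c.Sample :=
  (Measure.pi (fun i : Fin 2 => uniformOn (Set.univ : Set (Fin (c.numMsg i))))).prod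
    ((Measure.pi c.randLaw).prod
      (Measure.pi (fun _ : Fin 2 => Measure.pi (fun _ : Fin N => gaussianReal 0 1))))

/-- The message of user `i`. -/
def msg (i : Fin 2) (ω : c.Sample) : Fin (c.numMsg i) := ω.1 i

/-- The symbol sent by transmitter `i` over its cooperative link at time `k`. -/
def coopSymbol (ω : c.Sample) (i : Fin 2) (k : Fin N) : Fin (c.coopCard i k) :=
  c.coop i k (ω.1 i) (ω.2.1 i) (fun l => coopSymbol ω i.rev l.1)
termination_by k
decreasing_by exact l.2

/-- The channel input of transmitter `i` at time `k`. -/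
def input (i : Fin 2) (k : Fin N) (ω : c.Sample) : ℝ :=
  c.enc i k (ω.1 i) (ω.2.1 i) (fun l => c.coopSymbol ω i.rev l.1)

/-- The output block at receiver `i`, for direct gain `hd` and cross gain `hc`. -/
def output (hd hc : ℝ) (i : Fin 2) (ω : c.Sample) : Fin N → ℝ :=
  fun k => hd * c.input i k ω + hc * c.input i.rev k ω + ω.2.2 i k

/-- The cooperative link of each transmitter carries at most `N * CG` bits per block. -/
def CoopRateLE (CG : ℝ) : Prop :=
  ∀ i, ((∏ k, c.coopCard i k : ℕ) : ℝ) ≤ (2 : ℝ) ^ (N * CG)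

/-- Average power constraint `(1 / N) ∑ₖ E[|xᵢ,ₖ|²] ≤ P` at both transmitters. -/
def PowerLE (P : ℝ) : Prop :=
  ∀ i, ∑ k, ∫⁻ ω, ENNReal.ofReal (c.input i k ω ^ 2) ∂c.prob ≤ ENNReal.ofReal (N * P)

/-- The probability that receiver `i` does not recover the message of user `i`. -/
noncomputable def errorProb (hd hc : ℝ) (i : Fin 2) : ℝ :=
  c.prob.real {ω | c.dec i (c.output hd hc i ω) ≠ c.msg i ω}

/-- The information leaked about the message of user `i` to the other receiver. -/
noncomputable def leakage (hd hc : ℝ) (i : Fin 2) : ENNReal :=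
  mutualInfo c.prob (c.msg i) (c.output hd hc i.rev)

end ICCode

/-- `R` (in bits per channel use) is an achievable symmetric secrecy rate, under weak secrecy, of
the Gaussian symmetric interference channel with gains `hd`, `hc`, power `P` and cooperative
links of capacity `CG` bits per channel use. -/
def IsAchievableSymmSecrecyRate (hd hc P CG R : ℝ) : Prop :=
  ∀ ε : ℝ, 0 < ε → ∀ᶠ N : ℕ in atTop, ∃ c : ICCode N,
    c.CoopRateLE CG ∧ c.PowerLE P ∧
    ∀ i : Fin 2, R - ε ≤ Real.logb 2 (c.numMsg i) / N ∧
      c.errorProb hd hc i ≤ ε ∧ c.leakage hd hc i ≤ ENNReal.ofReal (N * ε)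

/-! The information-theoretic picture: message 1 can be read off the cooperative history V together
with s₁ = hd x₁ + z₁. Given V the data of the two transmitters are independent, so x₂ can be
resampled from its conditional law and added to s₁. The output y₂ reveals almost nothing about the
message, V is worth at most 2·N·CG bits, and what s₁ adds beyond y₂ is at most the Gaussian entropy
of the error in estimating s₁ linearly from y₂. With input correlation ρ, the error variance is the
argument of the logarithm in the bound.

No differential entropy is used. Let q(w | v, s) be the soft decoder, and compare s₁ with its
Gaussian surrogate a y₂ + σ z. Averaging `exp (log M * q)` over z and uniformly over v gives a
function A(w, y₂). The variational formula for divergence, tested on `log A`, shows that the mean of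
`log A` is at most the leakage plus 1, because the guesses of q sum to at most 1 over w. A change of
measure from s₁ to the surrogate, followed by Jensen's inequality, bounds `log M` times the success
probability by the mean of `log A`, plus `log |𝒱|`, plus the mean log-likelihood ratio. This is
`log_card_mul_integral_le`.

Choosing σ² as the linear estimation error makes the mean log-likelihood ratio at most `N * log σ`
(`log_card_mul_success_le`). `coopSymbol_eq_iff` supplies the conditional independence,
`exists_correlation` the time-averaged correlation of the inputs, and `exists_linear_estimator` the
formula in ρ. As the rate is symmetric, bounding one user suffices. Dividing by N and letting ε tend
to 0 finishes the proof. -/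

/-! ### Divergence and exponential moments -/

/-- The Fenchel–Young inequality for `x log x + 1 - x`. -/
lemma mul_le_klFun_add_exp {x : ℝ} (hx : 0 ≤ x) (g : ℝ) :
    x * g ≤ InformationTheory.klFun x + Real.exp g - 1 := by
  rw [InformationTheory.klFun_apply]
  rcases hx.eq_or_lt with rfl | hx
  · simp [Real.exp_nonneg]
  · have h := Real.add_one_le_exp (g - Real.log x)
    rw [Real.exp_sub, Real.exp_log hx, le_div_iff₀ hx] at h
    nlinarith

/-- Variational lower bound on the Kullback–Leibler divergence. -/
lemma integral_le_toReal_klDiv_add {α : Type*} [MeasurableSpace α] {μ ν : Measure α}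
    [IsProbabilityMeasure μ] [IsProbabilityMeasure ν]
    (h : InformationTheory.klDiv μ ν ≠ ⊤) {g : α → ℝ} (hg : Measurable g) {C : ℝ}
    (hC : ∀ x, |g x| ≤ C) :
    ∫ x, g x ∂μ ≤ (InformationTheory.klDiv μ ν).toReal + ∫ x, Real.exp (g x) ∂ν - 1 := by
  obtain ⟨hac, hint⟩ := InformationTheory.klDiv_ne_top_iff.1 h
  have hkl : Integrable (fun x => InformationTheory.klFun (μ.rnDeriv ν x).toReal) ν :=
    (InformationTheory.integrable_klFun_rnDeriv_iff hac).2 hint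
  have hexp : Integrable (fun x => Real.exp (g x)) ν := by
    refine Integrable.of_bound (by fun_prop) (Real.exp C) (ae_of_all _ fun x => ?_)
    rw [Real.norm_eq_abs, Real.abs_exp]
    exact Real.exp_le_exp.2 ((le_abs_self _).trans (hC x))
  have hgμ : Integrable g μ := Integrable.of_bound (by fun_prop) C (ae_of_all _ hC)
  rw [InformationTheory.toReal_klDiv_eq_integral_klFun hac, ← integral_rnDeriv_smul hac]
  have : ∫ x, (InformationTheory.klFun (μ.rnDeriv ν x).toReal + Real.exp (g x) - 1) ∂ν =
      ∫ x, InformationTheory.klFun (μ.rnDeriv ν x).toReal ∂ν + ∫ x, Real.exp (g x) ∂ν - 1 := by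
    rw [← integral_add hkl hexp, integral_sub (by exact hkl.add hexp) (integrable_const _)]
    simp
  rw [← this]
  refine integral_mono ?_ ((hkl.add hexp).sub (integrable_const _)) fun x => ?_
  · exact (integrable_rnDeriv_smul_iff hac).2 hgμ
  · simpa using mul_le_klFun_add_exp ENNReal.toReal_nonneg (g x)

/-- A random variable whose exponential moment is at most one has nonpositive mean. -/
lemma integral_nonpos_of_lintegral_exp_le_one {α : Type*} [MeasurableSpace α] {μ : Measure α}
    [IsProbabilityMeasure μ] {f : α → ℝ} (hf : Integrable f μ)
    (h : ∫⁻ x, ENNReal.ofReal (Real.exp (f x)) ∂μ ≤ 1) : ∫ x, f x ∂μ ≤ 0 := by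
  have hm : AEStronglyMeasurable (fun x => Real.exp (f x)) μ :=
    Real.continuous_exp.comp_aestronglyMeasurable hf.1
  have h0 : 0 ≤ᵐ[μ] fun x => Real.exp (f x) := ae_of_all _ fun x => (Real.exp_pos _).le
  have hi : Integrable (fun x => Real.exp (f x)) μ := by
    refine ⟨hm, ?_⟩
    rw [hasFiniteIntegral_iff_ofReal h0]
    exact h.trans_lt ENNReal.one_lt_top
  have h1 : ∫ x, Real.exp (f x) ∂μ ≤ 1 := by
    rw [integral_eq_lintegral_of_nonneg_ae h0 hm]
    exact ENNReal.toReal_le_of_le_ofReal zero_le_one (by simpa using h)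
  calc ∫ x, f x ∂μ ≤ ∫ x, (Real.exp (f x) - 1) ∂μ :=
        integral_mono hf (hi.sub (integrable_const _)) fun x => by
          have := Real.add_one_le_exp (f x)
          simp only
          linarith
    _ = ∫ x, Real.exp (f x) ∂μ - 1 := by
        rw [integral_sub hi (integrable_const _)]; simp
    _ ≤ 0 := by linarith

/-! ### Change of measure between Gaussian vectors -/

/-- The law of a product density under a product of probability measures. -/
lemma pi_withDensity_prod {ι : Type*} [Fintype ι] {α : ι → Type*} [∀ i, MeasurableSpace (α i)]
    (μ : ∀ i, Measure (α i)) [∀ i, IsProbabilityMeasure (μ i)] {d : ∀ i, α i → ENNReal}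
    (hd : ∀ i, Measurable (d i)) [∀ i, SigmaFinite ((μ i).withDensity (d i))] :
    Measure.pi (fun i => (μ i).withDensity (d i)) =
      (Measure.pi μ).withDensity (fun x => ∏ i, d i (x i)) := by
  refine Measure.pi_eq fun s hs => ?_
  rw [withDensity_apply _ (MeasurableSet.univ_pi hs), ← lintegral_indicator (MeasurableSet.univ_pi hs)]
  have hm : ∀ i, Measurable ((s i).indicator (d i)) := fun i => (hd i).indicator (hs i)
  have : ∀ x : ∀ i, α i, (Set.univ.pi s).indicator (fun x => ∏ i, d i (x i)) x =
      ∏ i, (s i).indicator (d i) (x i) := by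
    intro x
    by_cases hx : x ∈ Set.univ.pi s
    · rw [Set.indicator_of_mem hx]
      exact Finset.prod_congr rfl fun i _ => (Set.indicator_of_mem (hx i trivial) _).symm
    · rw [Set.indicator_of_notMem hx]
      simp only [Set.mem_pi, Set.mem_univ, true_implies, not_forall] at hx
      obtain ⟨i, hi⟩ := hx
      exact (Finset.prod_eq_zero (Finset.mem_univ i) (Set.indicator_of_notMem hi _)).symm
  simp_rw [this]
  have hind := iIndepFun_pi (μ := μ) (X := fun i => (s i).indicator (d i))
    fun i => (hm i).aemeasurable
  rw [lintegral_prod_eq_prod_lintegral_of_indepFun Finset.univ _ hind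
    fun i => (hm i).comp (measurable_pi_apply i)]
  refine Finset.prod_congr rfl fun i _ => ?_
  rw [withDensity_apply _ (hs i), ← lintegral_indicator (hs i)]
  exact (measurePreserving_eval μ i).lintegral_comp (hm i)

/-- The log-likelihood ratio, at the point `x + z`, of the Gaussian laws with means `x`, `y` and
variances `1`, `σ ^ 2`. -/
noncomputable def gaussianLLR (σ x y z : ℝ) : ℝ :=
  Real.log σ + (x + z - y) ^ 2 / (2 * σ ^ 2) - z ^ 2 / 2

lemma gaussianReal_map_add_mul {σ : ℝ} (y : ℝ) :
    (gaussianReal 0 1).map (fun z => y + σ * z) = gaussianReal y (σ ^ 2).toNNReal := by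
  have : (fun z => y + σ * z) = (fun z => y + z) ∘ fun z => σ * z := rfl
  rw [this, ← Measure.map_map (by fun_prop) (by fun_prop), gaussianReal_map_const_mul,
    gaussianReal_map_const_add]
  congr 1
  · simp
  · ext; simp [sq_nonneg]

/-- The weight is the density of N(y, σ²) relative to N(x, 1) at the point x + z, so reweighting the
noise z gives x + z the law of y + σz. -/
lemma gaussianReal_withDensity_exp_neg_gaussianLLR {σ : ℝ} (hσ : 0 < σ) (x y : ℝ) :
    ((gaussianReal 0 1).withDensity
      (fun z => ENNReal.ofReal (Real.exp (-gaussianLLR σ x y z)))) =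
        gaussianReal (y - x) (σ ^ 2).toNNReal := by
  have hσ' : (σ ^ 2).toNNReal ≠ 0 := (Real.toNNReal_pos.2 (pow_pos hσ 2)).ne'
  rw [gaussianReal_of_var_ne_zero _ one_ne_zero, gaussianReal_of_var_ne_zero _ hσ',
    ← withDensity_mul _ (by fun_prop) (by unfold gaussianLLR; fun_prop)]
  congr 1
  ext z
  simp only [Pi.mul_apply, gaussianPDF]
  rw [← ENNReal.ofReal_mul (gaussianPDFReal_nonneg _ _ _)]
  congr 1
  have hs : Real.sqrt (2 * Real.pi * σ ^ 2) = Real.sqrt (2 * Real.pi) * σ := by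
    rw [Real.sqrt_mul (by positivity), Real.sqrt_sq hσ.le]
  simp only [gaussianPDFReal, gaussianLLR, Real.coe_toNNReal _ (sq_nonneg σ), NNReal.coe_one, mul_one, hs]
  have : Real.exp (-(Real.log σ + (x + z - y) ^ 2 / (2 * σ ^ 2) - z ^ 2 / 2)) =
      σ⁻¹ * (Real.exp (-(x + z - y) ^ 2 / (2 * σ ^ 2)) * Real.exp (z ^ 2 / 2)) := by
    rw [← Real.exp_add]
    have h1 : σ⁻¹ = Real.exp (-Real.log σ) := by rw [Real.exp_neg, Real.exp_log hσ]
    rw [h1, ← Real.exp_add]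
    congr 1
    ring
  rw [this, show -(z - 0) ^ 2 / 2 = -(z ^ 2 / 2) by ring, Real.exp_neg,
    show -(z - (y - x)) ^ 2 = -(x + z - y) ^ 2 by ring]
  have := (Real.exp_pos (z ^ 2 / 2)).ne'
  field_simp

/-- Change of measure between two isotropic Gaussian vectors. -/
lemma lintegral_exp_neg_gaussianLLR {ι : Type*} [Fintype ι] {σ : ℝ} (hσ : 0 < σ) (x y : ι → ℝ)
    {F : (ι → ℝ) → ENNReal} (hF : Measurable F) :
    ∫⁻ z, ENNReal.ofReal (Real.exp (-∑ k, gaussianLLR σ (x k) (y k) (z k))) * F (x + z)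
        ∂Measure.pi (fun _ : ι => gaussianReal 0 1) =
      ∫⁻ z, F (fun k => y k + σ * z k) ∂Measure.pi (fun _ : ι => gaussianReal 0 1) := by
  have hm : ∀ k, Measurable fun z =>
      ENNReal.ofReal (Real.exp (-gaussianLLR σ (x k) (y k) z)) := fun k => by
    unfold gaussianLLR; fun_prop
  have hprod : ∀ z : ι → ℝ, ENNReal.ofReal (Real.exp (-∑ k, gaussianLLR σ (x k) (y k) (z k))) =
      ∏ k, ENNReal.ofReal (Real.exp (-gaussianLLR σ (x k) (y k) (z k))) := fun z => by
    rw [← ENNReal.ofReal_prod_of_nonneg fun _ _ => (Real.exp_pos _).le, ← Real.exp_sum,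
      Finset.sum_neg_distrib]
  have hinst : ∀ k, IsProbabilityMeasure ((gaussianReal 0 1).withDensity
      (fun z => ENNReal.ofReal (Real.exp (-gaussianLLR σ (x k) (y k) z)))) := fun k => by
    rw [gaussianReal_withDensity_exp_neg_gaussianLLR hσ]; infer_instance
  simp_rw [hprod]
  have hFx : Measurable fun z => F (x + z) := by fun_prop
  have hdm : Measurable fun z : ι → ℝ =>
      ∏ k, ENNReal.ofReal (Real.exp (-gaussianLLR σ (x k) (y k) (z k))) :=
    Finset.measurable_prod _ fun k _ => (hm k).comp (measurable_pi_apply k)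
  have h1 := lintegral_withDensity_eq_lintegral_mul
    (Measure.pi (fun _ : ι => gaussianReal 0 1)) hdm hFx
  simp only [Pi.mul_apply] at h1
  rw [← h1, ← pi_withDensity_prod (fun _ : ι => gaussianReal 0 1) hm]
  have hpush : (Measure.pi fun k => (gaussianReal 0 1).withDensity
      (fun z => ENNReal.ofReal (Real.exp (-gaussianLLR σ (x k) (y k) z)))).map (fun z => x + z) =
      (Measure.pi (fun _ : ι => gaussianReal 0 1)).map (fun z k => y k + σ * z k) := by
    rw [show (fun z : ι → ℝ => x + z) = fun z k => x k + z k from rfl]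
    rw [Measure.pi_map_pi (f := fun k z => x k + z) fun k => by fun_prop,
      Measure.pi_map_pi (f := fun k z => y k + σ * z) fun k => by fun_prop]
    congr 1
    ext1 k
    rw [gaussianReal_withDensity_exp_neg_gaussianLLR hσ, gaussianReal_map_add_mul,
      gaussianReal_map_const_add]
    congr 1
    ring
  rw [← lintegral_map hF (by fun_prop), hpush, lintegral_map hF (by fun_prop)]

/-! ### Converse for a soft decoder -/

lemma integral_uniformOn_univ {M : ℕ} (f : Fin M → ℝ) :
    ∫ w, f w ∂uniformOn (Set.univ : Set (Fin M)) = (∑ w, f w) / M := by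
  rcases Nat.eq_zero_or_pos M with rfl | hM
  · simp [Measure.eq_zero_of_isEmpty]
  have : NeZero M := ⟨hM.ne'⟩
  have : IsProbabilityMeasure (uniformOn (Set.univ : Set (Fin M))) :=
    isProbabilityMeasure_uniformOn Set.finite_univ Set.univ_nonempty
  rw [integral_fintype (Integrable.of_finite), Finset.sum_div]
  refine Finset.sum_congr rfl fun w _ => ?_
  rw [measureReal_def, uniformOn_univ]
  simp [div_eq_inv_mul]

lemma measurable_uncurry_of_finite {α β γ : Type*} [Finite α] [MeasurableSpace α]
    [MeasurableSingletonClass α] [MeasurableSpace β] [MeasurableSpace γ] {f : α → β → γ}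
    (hf : ∀ a, Measurable (f a)) : Measurable fun p : α × β => f p.1 p.2 :=
  measurable_from_prod_countable_right hf

/-- Bernoulli's inequality: the convex function p ↦ M^p lies below its chord on [0, 1]. Being linear
in p, the chord can be summed over messages using only that the guesses have total mass at most 1.
-/
lemma exp_log_mul_le {M p : ℝ} (hM : 1 ≤ M) (hp0 : 0 ≤ p) (hp1 : p ≤ 1) :
    Real.exp (Real.log M * p) ≤ 1 + p * (M - 1) := by
  have h := rpow_one_add_le_one_add_mul_self (s := M - 1) (by linarith) hp0 hp1
  rwa [add_sub_cancel, Real.rpow_def_of_pos (by linarith)] at h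

/-- A soft decoder `q` that guesses a uniform message `W` from a finite side information `V` and
from an output `X + z` of a Gaussian channel has a success probability which is controlled by the
information about `W` in `Y`, by the size of the range of `V`, and by the mean log-likelihood ratio
between `X + z` and a Gaussian approximation from `Y`. -/
theorem log_card_mul_integral_le {Ω ι 𝒱 : Type*} [MeasurableSpace Ω] [Fintype ι]
    [Fintype 𝒱] [Nonempty 𝒱] [MeasurableSpace 𝒱] [MeasurableSingletonClass 𝒱]
    {μ : Measure Ω} [IsProbabilityMeasure μ] {M : ℕ} (hM : 0 < M)
    {W : Ω → Fin M} {V : Ω → 𝒱} {X Y : Ω → ι → ℝ}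
    (hW : Measurable W) (hV : Measurable V) (hX : Measurable X) (hY : Measurable Y)
    (hWunif : μ.map W = uniformOn Set.univ)
    {q : Fin M → 𝒱 → (ι → ℝ) → ℝ} (hq : ∀ w v, Measurable (q w v))
    (hq0 : ∀ w v s, 0 ≤ q w v s) (hqsum : ∀ v s, ∑ w, q w v s ≤ 1)
    (hfin : mutualInfo μ W Y ≠ ⊤) {a σ : ℝ} (hσ : 0 < σ)
    (hL : Integrable (fun p : Ω × (ι → ℝ) => ∑ k, gaussianLLR σ (X p.1 k) (a * Y p.1 k) (p.2 k))
      (μ.prod (Measure.pi fun _ => gaussianReal 0 1))) :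
    Real.log M * ∫ p, q (W p.1) (V p.1) (X p.1 + p.2)
        ∂μ.prod (Measure.pi fun _ => gaussianReal 0 1) ≤
      (mutualInfo μ W Y).toReal + 1 + Real.log (Fintype.card 𝒱) +
        ∫ p, ∑ k, gaussianLLR σ (X p.1 k) (a * Y p.1 k) (p.2 k)
          ∂μ.prod (Measure.pi fun _ => gaussianReal 0 1) := by
  set γ : Measure (ι → ℝ) := Measure.pi fun _ => gaussianReal 0 1
  have hM1 : (1 : ℝ) ≤ M := by exact_mod_cast hM
  have hM0 : (0 : ℝ) < M := by linarith
  set t := Real.log M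
  have ht : 0 ≤ t := Real.log_nonneg hM1
  have hexpt : Real.exp t = M := Real.exp_log hM0
  have hq1 : ∀ w v s, q w v s ≤ 1 := fun w v s =>
    (Finset.single_le_sum (f := fun w => q w v s) (fun w _ => hq0 w v s) (Finset.mem_univ w)).trans
      (hqsum v s)
  have hexp_lb : ∀ w v s, 1 ≤ Real.exp (t * q w v s) := fun w v s =>
    Real.one_le_exp (mul_nonneg ht (hq0 w v s))
  have hexp_ub : ∀ w v s, Real.exp (t * q w v s) ≤ M := fun w v s => by
    rw [← hexpt]
    exact Real.exp_le_exp.2 (mul_le_of_le_one_right ht (hq1 w v s))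
  set n : ℝ := (Fintype.card 𝒱 : ℝ)
  have hn : 0 < n := by simp only [n]; exact_mod_cast Fintype.card_pos
  -- The decoder is fed the surrogate a y + σz. Averaging over z and then over all v leaves a
  -- function of (w, y) alone, which can be tested against the information between `W` and `Y`.
  let e : Fin M → 𝒱 → (ι → ℝ) → (ι → ℝ) → ℝ := fun w v y z =>
    Real.exp (t * q w v fun k => a * y k + σ * z k)
  have hem : ∀ w v, Measurable (Function.uncurry (e w v)) := fun w v =>
    Real.measurable_exp.comp (((hq w v).comp (by fun_prop)).const_mul t)
  have hei : ∀ w v y, Integrable (e w v y) γ := fun w v y =>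
    Integrable.of_bound ((hem w v).of_uncurry_left).aestronglyMeasurable M
      (ae_of_all _ fun z => by
        rw [Real.norm_eq_abs, Real.abs_exp]; exact hexp_ub _ _ _)
  let G : Fin M → 𝒱 → (ι → ℝ) → ℝ := fun w v y => ∫ z, e w v y z ∂γ
  have hGm : ∀ w v, Measurable (G w v) := fun w v =>
    ((hem w v).stronglyMeasurable.integral_prod_right).measurable
  have hG1 : ∀ w v y, 1 ≤ G w v y := fun w v y => by
    have := integral_mono (integrable_const 1) (hei w v y) fun z => hexp_lb _ _ _
    simpa using this
  have hGM : ∀ w v y, G w v y ≤ M := fun w v y => by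
    have := integral_mono (hei w v y) (integrable_const (M : ℝ)) fun z => hexp_ub _ _ _
    simpa using this
  let A : Fin M → (ι → ℝ) → ℝ := fun w y => (∑ v, G w v y) / n
  have hA1 : ∀ w y, 1 ≤ A w y := fun w y => by
    rw [le_div_iff₀ hn]
    calc 1 * n = ∑ _v : 𝒱, (1 : ℝ) := by simp [n]
      _ ≤ _ := Finset.sum_le_sum fun v _ => hG1 w v y
  have hAM : ∀ w y, A w y ≤ M := fun w y => by
    rw [div_le_iff₀ hn]
    calc ∑ v, G w v y ≤ ∑ _v : 𝒱, (M : ℝ) := Finset.sum_le_sum fun v _ => hGM w v y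
      _ = M * n := by simp [n, mul_comm]
  have hApos : ∀ w y, 0 < A w y := fun w y => lt_of_lt_of_le one_pos (hA1 w y)
  have hAm : Measurable fun p : Fin M × (ι → ℝ) => A p.1 p.2 :=
    measurable_uncurry_of_finite fun w =>
      (Finset.measurable_sum _ fun v _ => hGm w v).div_const n
  let g : Fin M × (ι → ℝ) → ℝ := fun p => Real.log (A p.1 p.2)
  have hgm : Measurable g := Real.measurable_log.comp hAm
  have hgb : ∀ p, |g p| ≤ t := fun p => by
    rw [abs_of_nonneg (Real.log_nonneg (hA1 _ _))]
    exact Real.log_le_log (hApos _ _) (hAM _ _)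
  have hWY : Measurable fun ω => (W ω, Y ω) := hW.prodMk hY
  have : IsProbabilityMeasure (μ.map fun ω => (W ω, Y ω)) :=
    Measure.isProbabilityMeasure_map hWY.aemeasurable
  have : IsProbabilityMeasure (μ.map W) := Measure.isProbabilityMeasure_map hW.aemeasurable
  have : IsProbabilityMeasure (μ.map Y) := Measure.isProbabilityMeasure_map hY.aemeasurable
  have hAint : Integrable (fun p : Fin M × (ι → ℝ) => A p.1 p.2) ((μ.map W).prod (μ.map Y)) :=
    Integrable.of_bound hAm.aestronglyMeasurable M (ae_of_all _ fun p => by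
      rw [Real.norm_eq_abs, abs_of_pos (hApos _ _)]; exact hAM _ _)
  -- the mean of `A` under the product measure
  have hAmean : ∫ p, Real.exp (g p) ∂(μ.map W).prod (μ.map Y) ≤ 2 := by
    have h1 : ∀ p, Real.exp (g p) = A p.1 p.2 := fun p => Real.exp_log (hApos _ _)
    simp_rw [h1]
    rw [integral_prod_symm _ hAint]
    have h2 : ∀ y, ∫ w, A w y ∂μ.map W ≤ 2 := fun y => by
      rw [hWunif, integral_uniformOn_univ, div_le_iff₀ hM0, ← Finset.sum_div, div_le_iff₀ hn,
        Finset.sum_comm]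
      -- The chord bound gives at most M + (M - 1) for the sum over w, so a uniform message
      -- independent of y has mean at most 2.
      have h3 : ∀ v, ∑ w, G w v y ≤ 2 * M := fun v => by
        rw [← integral_finsetSum _ fun w _ => hei w v y]
        have h4 : ∀ z, ∑ w, e w v y z ≤ 2 * M := fun z => by
          calc ∑ w, e w v y z ≤ ∑ w, (1 + q w v (fun k => a * y k + σ * z k) * (M - 1)) :=
                Finset.sum_le_sum fun w _ => exp_log_mul_le hM1 (hq0 _ _ _) (hq1 _ _ _)
            _ = M + (∑ w, q w v (fun k => a * y k + σ * z k)) * (M - 1) := by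
                rw [Finset.sum_add_distrib, Finset.sum_mul]; simp
            _ ≤ M + 1 * (M - 1) := by
                have := hqsum v (fun k => a * y k + σ * z k)
                gcongr
            _ ≤ 2 * M := by linarith
        have := integral_mono (integrable_finsetSum _ fun w _ => hei w v y)
          (integrable_const (2 * (M : ℝ))) h4
        simpa using this
      calc ∑ v, ∑ w, G w v y ≤ ∑ _v : 𝒱, 2 * (M : ℝ) := Finset.sum_le_sum fun v _ => h3 v
        _ = 2 * M * n := by simp [n, mul_comm]
    have := integral_mono_of_nonneg (μ := μ.map Y) (f := fun y => ∫ w, A w y ∂μ.map W)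
      (ae_of_all _ fun y => integral_nonneg fun w => (hApos w y).le)
      (integrable_const (2 : ℝ)) (ae_of_all _ h2)
    simpa using this
  -- the information term
  have hinfo := integral_le_toReal_klDiv_add hfin hgm hgb
  rw [integral_map hWY.aemeasurable hgm.aestronglyMeasurable] at hinfo
  -- the change of measure term
  let L : Ω × (ι → ℝ) → ℝ := fun p => ∑ k, gaussianLLR σ (X p.1 k) (a * Y p.1 k) (p.2 k)
  have hqm : Measurable fun p : (Fin M × 𝒱) × (ι → ℝ) => q p.1.1 p.1.2 p.2 :=
    measurable_uncurry_of_finite (f := fun w : Fin M × 𝒱 => q w.1 w.2) fun w => hq w.1 w.2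
  let f : Ω × (ι → ℝ) → ℝ := fun p => q (W p.1) (V p.1) (X p.1 + p.2)
  have hfm : Measurable f :=
    hqm.comp (((hW.comp measurable_fst).prodMk (hV.comp measurable_fst)).prodMk
      ((hX.comp measurable_fst).add measurable_snd))
  have hfi : Integrable f (μ.prod γ) := Integrable.of_bound hfm.aestronglyMeasurable 1
    (ae_of_all _ fun p => by
      rw [Real.norm_eq_abs, abs_of_nonneg (hq0 _ _ _)]; exact hq1 _ _ _)
  let g' : Ω × (ι → ℝ) → ℝ := fun p => g (W p.1, Y p.1)
  have hgm' : Measurable g' := hgm.comp (hWY.comp measurable_fst)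
  have hgi : Integrable g' (μ.prod γ) := Integrable.of_bound hgm'.aestronglyMeasurable t
    (ae_of_all _ fun p => hgb _)
  have hD : Integrable (fun p => t * f p - g' p - Real.log n - L p) (μ.prod γ) :=
    (((hfi.const_mul t).sub hgi).sub (integrable_const _)).sub hL
  have hLm : Measurable L := by
    refine Finset.measurable_sum _ fun k _ => ?_
    unfold gaussianLLR
    fun_prop
  -- For fixed ω the factor `exp (-L)` turns X + z into a Y + σz, and the integral becomes G(W, V,
  -- Y) divided by the sum of G(W, v, Y) over v. One term is at most the whole sum; replacing that
  -- sum by the average costs `log n`.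
  have hle : ∫⁻ p, ENNReal.ofReal (Real.exp (t * f p - g' p - Real.log n - L p)) ∂μ.prod γ ≤ 1 := by
    rw [lintegral_prod _ (by fun_prop)]
    have hin : ∀ ω, ∫⁻ z, ENNReal.ofReal
        (Real.exp (t * f (ω, z) - g' (ω, z) - Real.log n - L (ω, z))) ∂γ ≤ 1 := fun ω => by
      set S := ∑ v, G (W ω) v (Y ω)
      have hS : 0 < S := Finset.sum_pos (fun v _ => lt_of_lt_of_le one_pos (hG1 _ v _))
        Finset.univ_nonempty
      have hsplit : ∀ z, ENNReal.ofReal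
          (Real.exp (t * f (ω, z) - g' (ω, z) - Real.log n - L (ω, z))) =
          ENNReal.ofReal (Real.exp (-∑ k, gaussianLLR σ (X ω k) (a * Y ω k) (z k))) *
            ENNReal.ofReal (S⁻¹ * Real.exp (t * q (W ω) (V ω) (X ω + z))) := fun z => by
        rw [← ENNReal.ofReal_mul (Real.exp_pos _).le]
        congr 1
        have hg' : g' (ω, z) = Real.log S - Real.log n := by
          simp only [g', g, A]
          rw [Real.log_div hS.ne' hn.ne']
        have hSi : S⁻¹ = Real.exp (-Real.log S) := by rw [Real.exp_neg, Real.exp_log hS]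
        rw [hg', hSi, ← Real.exp_add, ← Real.exp_add]
        congr 1
        simp only [f, L]
        ring
      simp_rw [hsplit]
      rw [lintegral_exp_neg_gaussianLLR hσ (X ω) (fun k => a * Y ω k)
        (F := fun s => ENNReal.ofReal (S⁻¹ * Real.exp (t * q (W ω) (V ω) s)))
        (((Real.measurable_exp.comp ((hq _ _).const_mul t)).const_mul _).ennreal_ofReal)]
      rw [← ofReal_integral_eq_lintegral_ofReal ((hei (W ω) (V ω) (Y ω)).const_mul S⁻¹)
        (ae_of_all _ fun z => mul_nonneg (inv_nonneg.2 hS.le) (Real.exp_pos _).le),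
        integral_const_mul]
      rw [ENNReal.ofReal_le_one, inv_mul_le_one₀ hS]
      exact Finset.single_le_sum (f := fun v => G (W ω) v (Y ω))
        (fun v _ => zero_le_one.trans (hG1 _ v _)) (Finset.mem_univ (V ω))
    calc _ ≤ ∫⁻ _, 1 ∂μ := lintegral_mono hin
      _ = 1 := by simp
  have hfinal := integral_nonpos_of_lintegral_exp_le_one hD hle
  rw [integral_sub (by exact ((hfi.const_mul t).sub hgi).sub (integrable_const _)) hL,
    integral_sub (by exact (hfi.const_mul t).sub hgi) (integrable_const _),
    integral_sub (hfi.const_mul t) hgi, integral_const_mul] at hfinal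
  have hg'int : ∫ p, g' p ∂μ.prod γ = ∫ ω, g (W ω, Y ω) ∂μ := by
    simp only [g']
    rw [integral_fun_fst (f := fun ω => g (W ω, Y ω))]
    simp
  rw [hg'int] at hfinal
  simp only [integral_const, probReal_univ, one_smul] at hfinal
  simp only [mutualInfo]
  linarith

/-! ### Second moments with independent Gaussian noise -/

lemma measurePreserving_pi_gaussian_eval {ι : Type*} [Fintype ι] (k : ι) :
    MeasurePreserving (fun z : ι → ℝ => z k) (Measure.pi fun _ => gaussianReal 0 1)
      (gaussianReal 0 1) :=
  measurePreserving_eval (fun _ : ι => gaussianReal 0 1) k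

lemma memLp_pi_gaussian_eval {ι : Type*} [Fintype ι] (k : ι) :
    MemLp (fun z : ι → ℝ => z k) 2 (Measure.pi fun _ => gaussianReal 0 1) :=
  (memLp_id_gaussianReal 2).comp_measurePreserving (measurePreserving_pi_gaussian_eval k)

lemma integral_pi_gaussian_eval {ι : Type*} [Fintype ι] (k : ι) :
    ∫ z : ι → ℝ, z k ∂(Measure.pi fun _ => gaussianReal 0 1) = 0 := by
  have h := (measurePreserving_pi_gaussian_eval k).map_eq
  have h1 := integral_id_gaussianReal (μ := 0) (v := 1)
  rwa [← h, integral_map (measurable_pi_apply k).aemeasurable (by fun_prop)] at h1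

lemma integral_pi_gaussian_eval_sq {ι : Type*} [Fintype ι] (k : ι) :
    ∫ z : ι → ℝ, z k ^ 2 ∂(Measure.pi fun _ => gaussianReal 0 1) = 1 := by
  have h := (measurePreserving_pi_gaussian_eval k).map_eq
  have h1 : ∫ x, x ^ 2 ∂gaussianReal 0 1 = 1 := by
    have := variance_fun_id_gaussianReal (μ := 0) (v := 1)
    rw [variance_eq_integral (by fun_prop)] at this
    simpa using this
  rwa [← h, integral_map (measurable_pi_apply k).aemeasurable (by fun_prop)] at h1

lemma memLp_add_mul_gaussian {Ω ι : Type*} [MeasurableSpace Ω] [Fintype ι] {μ : Measure Ω}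
    [IsProbabilityMeasure μ] {h : Ω → ℝ} (hh : MemLp h 2 μ) (b : ℝ) (k : ι) :
    MemLp (fun p : Ω × (ι → ℝ) => h p.1 + b * p.2 k) 2
      (μ.prod (Measure.pi fun _ => gaussianReal 0 1)) :=
  (hh.comp_measurePreserving measurePreserving_fst).add
    (((memLp_pi_gaussian_eval k).comp_measurePreserving measurePreserving_snd).const_mul b)

/-- The second moment of a random variable with an independent Gaussian perturbation. -/
lemma integral_sq_add_mul_gaussian {Ω ι : Type*} [MeasurableSpace Ω] [Fintype ι] {μ : Measure Ω}
    [IsProbabilityMeasure μ] {h : Ω → ℝ} (hh : MemLp h 2 μ) (b : ℝ) (k : ι) :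
    ∫ p : Ω × (ι → ℝ), (h p.1 + b * p.2 k) ^ 2 ∂μ.prod (Measure.pi fun _ => gaussianReal 0 1) =
      ∫ ω, h ω ^ 2 ∂μ + b ^ 2 := by
  set γ : Measure (ι → ℝ) := Measure.pi fun _ => gaussianReal 0 1
  have h1 : MemLp (fun p : Ω × (ι → ℝ) => h p.1) 2 (μ.prod γ) :=
    hh.comp_measurePreserving measurePreserving_fst
  have h2 : MemLp (fun p : Ω × (ι → ℝ) => p.2 k) 2 (μ.prod γ) :=
    (memLp_pi_gaussian_eval k).comp_measurePreserving measurePreserving_snd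
  have e : ∀ p : Ω × (ι → ℝ), (h p.1 + b * p.2 k) ^ 2 =
      h p.1 ^ 2 + 2 * b * (h p.1 * p.2 k) + b ^ 2 * p.2 k ^ 2 := fun p => by ring
  simp_rw [e]
  have i12 : Integrable (fun p : Ω × (ι → ℝ) => h p.1 * p.2 k) (μ.prod γ) := h1.integrable_mul h2
  rw [integral_add (by exact h1.integrable_sq.add (i12.const_mul _)) (h2.integrable_sq.const_mul _),
    integral_add h1.integrable_sq (i12.const_mul _), integral_const_mul, integral_const_mul,
    integral_prod_mul (fun ω => h ω) (fun z : ι → ℝ => z k), integral_pi_gaussian_eval,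
    integral_fun_fst (f := fun ω => h ω ^ 2), integral_fun_snd (f := fun z : ι → ℝ => z k ^ 2),
    integral_pi_gaussian_eval_sq]
  simp

/-! ### Soft decoders from rectangular fibres -/

lemma lintegral_comp_eq_sum_fiber {T 𝒱 : Type*} [MeasurableSpace T] [Fintype 𝒱]
    {τ : Measure T} {V : T → 𝒱} (hV : ∀ v, MeasurableSet (V ⁻¹' {v})) {h : 𝒱 → T → ENNReal}
    (hh : ∀ v, Measurable (h v)) :
    ∫⁻ t, h (V t) t ∂τ = ∑ v, ∫⁻ t in V ⁻¹' {v}, h v t ∂τ := by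
  classical
  have e : ∀ t, h (V t) t = ∑ v, (V ⁻¹' {v}).indicator (h v) t := fun t => by
    rw [Finset.sum_eq_single (V t)]
    · simp
    · intro v _ hv
      exact Set.indicator_of_notMem (by simpa using hv.symm) _
    · simp
  simp_rw [e]
  rw [lintegral_finsetSum _ fun v _ => (hh v).indicator (hV v)]
  exact Finset.sum_congr rfl fun v _ => lintegral_indicator (hV v) _

/-- The probability that a decoder `D` outputs `w` from `s + x t₂`, where `t₂` follows `τ`
conditioned on `B v`. -/
noncomputable def softDecoder {T₂ 𝒱 ι : Type*} [MeasurableSpace T₂] {M : ℕ} (τ : Measure T₂) (B : 𝒱 → Set T₂) (D : (ι → ℝ) → Fin M)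
    (x : 𝒱 → T₂ → ι → ℝ) (w : Fin M) (v : 𝒱) (s : ι → ℝ) : ℝ :=
  (τ[|B v]).real {t | D (s + x v t) = w}

lemma softDecoder_nonneg {T₂ 𝒱 ι : Type*} [MeasurableSpace T₂] {M : ℕ} (τ : Measure T₂)
    (B : 𝒱 → Set T₂) (D : (ι → ℝ) → Fin M) (x : 𝒱 → T₂ → ι → ℝ) (w : Fin M) (v : 𝒱)
    (s : ι → ℝ) : 0 ≤ softDecoder τ B D x w v s :=
  measureReal_nonneg

lemma measurable_softDecoder {T₂ 𝒱 ι : Type*} [MeasurableSpace T₂] {M : ℕ} {τ₂ : Measure T₂}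
    {B : 𝒱 → Set T₂} {D : (ι → ℝ) → Fin M} {x₂ : 𝒱 → T₂ → ι → ℝ} (hD : Measurable D) (hx₂ : ∀ v, Measurable (x₂ v)) (w : Fin M)
    (v : 𝒱) : Measurable (softDecoder τ₂ B D x₂ w v) := by
  have hm : MeasurableSet {p : (ι → ℝ) × T₂ | D (p.1 + x₂ v p.2) = w} :=
    (hD.comp (measurable_fst.add ((hx₂ v).comp measurable_snd))) (measurableSet_singleton w)
  exact (measurable_measure_prodMk_left hm).ennreal_toReal

lemma measurable_softDecoder_comp {Ω T₂ 𝒱 ι : Type*} [MeasurableSpace Ω] [MeasurableSpace T₂]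
    [Finite 𝒱] [MeasurableSpace 𝒱] [MeasurableSingletonClass 𝒱] {M : ℕ} {τ₂ : Measure T₂}
    {B : 𝒱 → Set T₂} {D : (ι → ℝ) → Fin M} {x₂ : 𝒱 → T₂ → ι → ℝ} (hD : Measurable D)
    (hx₂ : ∀ v, Measurable (x₂ v)) {W : Ω → Fin M} {V : Ω → 𝒱} {S : Ω → ι → ℝ}
    (hW : Measurable W) (hV : Measurable V) (hS : Measurable S) :
    Measurable fun ω => softDecoder τ₂ B D x₂ (W ω) (V ω) (S ω) := by
  have h : Measurable (Function.uncurry fun (w : Fin M × 𝒱) s => softDecoder τ₂ B D x₂ w.1 w.2 s) :=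
    measurable_from_prod_countable_right fun w => measurable_softDecoder hD hx₂ w.1 w.2
  have hp : Measurable fun ω => ((W ω, V ω), S ω) := (hW.prodMk hV).prodMk hS
  simpa only [Function.comp_def, Function.uncurry] using h.comp hp

/-- Different guesses are disjoint events under one conditional law. Only an inequality is claimed,
since conditioning on a null set gives the zero measure. -/
lemma sum_softDecoder_le {T₂ 𝒱 ι : Type*} [MeasurableSpace T₂] {M : ℕ} {τ₂ : Measure T₂}
    {B : 𝒱 → Set T₂} {D : (ι → ℝ) → Fin M} {x₂ : 𝒱 → T₂ → ι → ℝ} (hD : Measurable D) (hx₂ : ∀ v, Measurable (x₂ v)) (v : 𝒱)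
    (s : ι → ℝ) : ∑ w, softDecoder τ₂ B D x₂ w v s ≤ 1 := by
  have hm : ∀ w, MeasurableSet {t | D (s + x₂ v t) = w} := fun w =>
    (hD.comp ((hx₂ v).const_add s)) (measurableSet_singleton w)
  have hdisj : Pairwise (Function.onFun Disjoint fun w => {t | D (s + x₂ v t) = w}) := by
    intro w w' hw
    exact Set.disjoint_left.2 fun t h h' => hw (h.symm.trans h')
  unfold softDecoder
  rw [← measureReal_biUnion_finset (fun _ _ _ _ h => hdisj h) fun w _ => hm w]
  exact measureReal_le_one

/-- If the fibres of `V` are rectangles, then the success probability of a decoder of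
`x₁ + x₂ + z` is the mean success probability of a soft decoder that uses only `V` and `x₁ + z`. -/
lemma measureReal_success_eq_integral_softDecoder {T₁ T₂ 𝒱 ι : Type*} [MeasurableSpace T₁]
    [MeasurableSpace T₂] [Fintype 𝒱] [MeasurableSpace 𝒱] [MeasurableSingletonClass 𝒱] {M : ℕ}
    {τ₁ : Measure T₁} {τ₂ : Measure T₂} [IsProbabilityMeasure τ₁] [IsProbabilityMeasure τ₂]
    {A : 𝒱 → Set T₁} {B : 𝒱 → Set T₂} {D : (ι → ℝ) → Fin M} {x₁ : 𝒱 → T₁ → ι → ℝ}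
    {x₂ : 𝒱 → T₂ → ι → ℝ} {W : T₁ → Fin M} (hW : Measurable W)
    (hB : ∀ v, MeasurableSet (B v)) (hD : Measurable D)
    (hx₁ : ∀ v, Measurable (x₁ v)) (hx₂ : ∀ v, Measurable (x₂ v))
    {V : T₁ × T₂ → 𝒱} (hV : Measurable V)
    (hVrect : ∀ t₁ t₂ v, V (t₁, t₂) = v ↔ t₁ ∈ A v ∧ t₂ ∈ B v)
    (γ : Measure (ι → ℝ)) [IsProbabilityMeasure γ] :
    ((τ₁.prod τ₂).prod γ).real {p | D (x₁ (V p.1) p.1.1 + p.2 + x₂ (V p.1) p.1.2) = W p.1.1} =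
      ∫ p, softDecoder τ₂ B D x₂ (W p.1.1) (V p.1) (x₁ (V p.1) p.1.1 + p.2)
        ∂(τ₁.prod τ₂).prod γ := by
  have hx₁V : Measurable fun p : T₁ × T₂ => x₁ (V p) p.1 :=
    (measurable_uncurry_of_finite hx₁).comp (hV.prodMk measurable_fst)
  have hx₂V : Measurable fun p : T₁ × T₂ => x₂ (V p) p.2 :=
    (measurable_uncurry_of_finite hx₂).comp (hV.prodMk measurable_snd)
  have hS : Measurable fun p : (T₁ × T₂) × (ι → ℝ) => x₁ (V p.1) p.1.1 + p.2 :=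
    (hx₁V.comp measurable_fst).add measurable_snd
  have hS₂ : Measurable fun p : (T₁ × T₂) × (ι → ℝ) =>
      x₁ (V p.1) p.1.1 + p.2 + x₂ (V p.1) p.1.2 := hS.add (hx₂V.comp measurable_fst)
  have hD₂ : Measurable fun p : (T₁ × T₂) × (ι → ℝ) =>
      D (x₁ (V p.1) p.1.1 + p.2 + x₂ (V p.1) p.1.2) := hD.comp hS₂
  have hWp : Measurable fun p : (T₁ × T₂) × (ι → ℝ) => W p.1.1 :=
    hW.comp (measurable_fst.comp measurable_fst)
  have hset : MeasurableSet {p : (T₁ × T₂) × (ι → ℝ) |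
      D (x₁ (V p.1) p.1.1 + p.2 + x₂ (V p.1) p.1.2) = W p.1.1} := measurableSet_eq_fun hD₂ hWp
  have hqm : Measurable fun p : (T₁ × T₂) × (ι → ℝ) =>
      softDecoder τ₂ B D x₂ (W p.1.1) (V p.1) (x₁ (V p.1) p.1.1 + p.2) :=
    measurable_softDecoder_comp hD hx₂ hWp (hV.comp measurable_fst) hS
  rw [integral_eq_lintegral_of_nonneg_ae (ae_of_all _ fun p => softDecoder_nonneg ..)
    hqm.aestronglyMeasurable, measureReal_def]
  congr 1
  rw [← lintegral_indicator_one hset]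
  -- The integral over t₂ is taken innermost: with t₁ and z fixed, the claim reduces to conditioning
  -- t₂ on the value of `V`.
  have hswap : ∀ F : (T₁ × T₂) × (ι → ℝ) → ENNReal, Measurable F →
      ∫⁻ p, F p ∂(τ₁.prod τ₂).prod γ = ∫⁻ t₁, ∫⁻ z, ∫⁻ t₂, F ((t₁, t₂), z) ∂τ₂ ∂γ ∂τ₁ := by
    intro F hF
    rw [lintegral_prod _ hF.aemeasurable, lintegral_prod _ hF.lintegral_prod_right'.aemeasurable]
    refine lintegral_congr fun t₁ => lintegral_lintegral_swap (Measurable.aemeasurable ?_)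
    exact hF.comp ((measurable_const.prodMk measurable_fst).prodMk measurable_snd)
  rw [hswap _ (measurable_one.indicator hset), hswap _ hqm.ennreal_ofReal]
  refine lintegral_congr fun t₁ => lintegral_congr fun z => ?_
  have hVt : ∀ v, MeasurableSet ((fun t₂ => V (t₁, t₂)) ⁻¹' {v}) := fun v =>
    (hV.comp measurable_prodMk_left) (measurableSet_singleton v)
  have hm : ∀ v, MeasurableSet {t | D (x₁ v t₁ + z + x₂ v t) = W t₁} := fun v =>
    (hD.comp ((hx₂ v).const_add _)) (measurableSet_singleton _)
  have e1 := lintegral_comp_eq_sum_fiber (τ := τ₂) hVt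
    (h := fun v => {t | D (x₁ v t₁ + z + x₂ v t) = W t₁}.indicator 1)
    fun v => measurable_one.indicator (hm v)
  have e2 := lintegral_comp_eq_sum_fiber (τ := τ₂) hVt
    (h := fun v _ => ENNReal.ofReal (softDecoder τ₂ B D x₂ (W t₁) v (x₁ v t₁ + z)))
    fun v => measurable_const
  refine (Eq.trans ?_ e1).trans ((Finset.sum_congr rfl fun v _ => ?_).trans e2.symm)
  · exact lintegral_congr fun t₂ => rfl
  rw [setLIntegral_const, lintegral_indicator_one (hm v), Measure.restrict_apply (hm v)]
  -- If t₁ lies in A v, the fibre of t₂ is exactly B v, and conditional probability times the mass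
  -- of B v is the joint probability. Otherwise the fibre is empty and both sides vanish.
  by_cases ht : t₁ ∈ A v
  · have hfib : (fun t₂ => V (t₁, t₂)) ⁻¹' {v} = B v := by
      ext t₂
      simp [hVrect, ht]
    rw [hfib, softDecoder, measureReal_def, ENNReal.ofReal_toReal (measure_ne_top _ _),
      cond_mul_eq_inter (hB v), Set.inter_comm]
  · have hfib : (fun t₂ => V (t₁, t₂)) ⁻¹' {v} = ∅ := by
      ext t₂
      simp [hVrect, ht]
    simp [hfib]

/-! ### Secrecy bound for one block -/

/-- The mean log-likelihood ratio of a residual with a Gaussian noise term. -/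
lemma integral_gaussianLLR {Ω ι : Type*} [MeasurableSpace Ω] [Fintype ι] {μ : Measure Ω}
    [IsProbabilityMeasure μ] {x y : Ω → ℝ} (h : MemLp (fun ω => x ω - y ω) 2 μ) (σ : ℝ) (k : ι) :
    Integrable (fun p : Ω × (ι → ℝ) => gaussianLLR σ (x p.1) (y p.1) (p.2 k))
        (μ.prod (Measure.pi fun _ => gaussianReal 0 1)) ∧
      ∫ p : Ω × (ι → ℝ), gaussianLLR σ (x p.1) (y p.1) (p.2 k)
          ∂μ.prod (Measure.pi fun _ => gaussianReal 0 1) =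
        Real.log σ + (∫ ω, (x ω - y ω) ^ 2 ∂μ + 1) / (2 * σ ^ 2) - 1 / 2 := by
  have e : ∀ p : Ω × (ι → ℝ), gaussianLLR σ (x p.1) (y p.1) (p.2 k) =
      Real.log σ + (x p.1 - y p.1 + 1 * p.2 k) ^ 2 / (2 * σ ^ 2) - p.2 k ^ 2 / 2 := fun p => by
    rw [gaussianLLR]; ring
  simp_rw [e]
  have h1 := ((memLp_add_mul_gaussian h 1 k).integrable_sq).div_const (2 * σ ^ 2)
  have h2 : Integrable (fun p : Ω × (ι → ℝ) => p.2 k ^ 2 / 2)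
      (μ.prod (Measure.pi fun _ => gaussianReal 0 1)) :=
    (((memLp_pi_gaussian_eval k).comp_measurePreserving
      measurePreserving_snd).integrable_sq).div_const 2
  refine ⟨((integrable_const _).add h1).sub h2, ?_⟩
  rw [integral_sub (by exact (integrable_const _).add h1) h2, integral_add (integrable_const _) h1,
    integral_div, integral_div, integral_sq_add_mul_gaussian h,
    integral_fun_snd (f := fun z : ι → ℝ => z k ^ 2), integral_pi_gaussian_eval_sq]
  simp

/-- The secrecy bound for one block: the message of the first transmitter is decoded from
`hd x₁ + hc x₂ + z₁`, and `hd x₂ + hc x₁ + z₂` is the output at the other receiver. -/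
theorem log_card_mul_success_le {T₁ T₂ 𝒱 ι : Type*} [MeasurableSpace T₁]
    [MeasurableSpace T₂] [Fintype ι] [Fintype 𝒱] [MeasurableSpace 𝒱] [MeasurableSingletonClass 𝒱]
    {τ₁ : Measure T₁} {τ₂ : Measure T₂} [IsProbabilityMeasure τ₁] [IsProbabilityMeasure τ₂]
    {M : ℕ} (hM : 0 < M) {A : 𝒱 → Set T₁} {B : 𝒱 → Set T₂} {D : (ι → ℝ) → Fin M}
    {x₁ : 𝒱 → T₁ → ι → ℝ} {x₂ : 𝒱 → T₂ → ι → ℝ} {W : T₁ → Fin M} (hW : Measurable W)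
    (hWunif : τ₁.map W = uniformOn Set.univ)
    (hB : ∀ v, MeasurableSet (B v)) (hD : Measurable D)
    (hx₁ : ∀ v, Measurable (x₁ v)) (hx₂ : ∀ v, Measurable (x₂ v))
    {V : T₁ × T₂ → 𝒱} (hV : Measurable V)
    (hVrect : ∀ t₁ t₂ v, V (t₁, t₂) = v ↔ t₁ ∈ A v ∧ t₂ ∈ B v)
    (hL₁ : ∀ k, MemLp (fun t => x₁ (V t) t.1 k) 2 (τ₁.prod τ₂))
    (hL₂ : ∀ k, MemLp (fun t => x₂ (V t) t.2 k) 2 (τ₁.prod τ₂))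
    (hd hc : ℝ)
    (hfin : mutualInfo ((τ₁.prod τ₂).prod (Measure.pi fun _ : ι => gaussianReal 0 1))
      (fun p => W p.1.1) (fun p => hd • x₂ (V p.1) p.1.2 + hc • x₁ (V p.1) p.1.1 + p.2) ≠ ⊤)
    {a σ : ℝ} (hσ : 0 < σ)
    (hmse : ∑ k, ∫ t, ((hd - a * hc) * x₁ (V t) t.1 k - a * hd * x₂ (V t) t.2 k) ^ 2
      ∂τ₁.prod τ₂ ≤ Fintype.card ι * (σ ^ 2 - 1 - a ^ 2)) :
    Real.log M * (((τ₁.prod τ₂).prod (Measure.pi fun _ : ι => gaussianReal 0 1)).prod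
        (Measure.pi fun _ : ι => gaussianReal 0 1)).real
        {p | D (hd • x₁ (V p.1.1) p.1.1.1 + p.2 + hc • x₂ (V p.1.1) p.1.1.2) = W p.1.1.1} ≤
      (mutualInfo ((τ₁.prod τ₂).prod (Measure.pi fun _ : ι => gaussianReal 0 1))
        (fun p => W p.1.1)
        (fun p => hd • x₂ (V p.1) p.1.2 + hc • x₁ (V p.1) p.1.1 + p.2)).toReal + 1 +
        Real.log (Fintype.card 𝒱) + Fintype.card ι * Real.log σ := by
  set γ : Measure (ι → ℝ) := Measure.pi fun _ => gaussianReal 0 1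
  set μ := (τ₁.prod τ₂).prod γ
  have : Nonempty (T₁ × T₂) := nonempty_of_isProbabilityMeasure (τ₁.prod τ₂)
  have : Nonempty 𝒱 := ‹Nonempty (T₁ × T₂)›.map V
  have hX₁ : Measurable fun p : T₁ × T₂ => x₁ (V p) p.1 := by
    simpa only [Function.comp_def] using
      (measurable_uncurry_of_finite hx₁).comp (hV.prodMk measurable_fst)
  have hX₂ : Measurable fun p : T₁ × T₂ => x₂ (V p) p.2 := by
    simpa only [Function.comp_def] using
      (measurable_uncurry_of_finite hx₂).comp (hV.prodMk measurable_snd)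
  have hWm : Measurable fun p : (T₁ × T₂) × (ι → ℝ) => W p.1.1 :=
    hW.comp (measurable_fst.comp measurable_fst)
  have hWmap : μ.map (fun p : (T₁ × T₂) × (ι → ℝ) => W p.1.1) = uniformOn Set.univ := by
    rw [← hWunif, ← (measurePreserving_fst (μ := τ₁) (ν := τ₂)).map_eq,
      ← (measurePreserving_fst (μ := τ₁.prod τ₂) (ν := γ)).map_eq,
      Measure.map_map measurable_fst measurable_fst,
      Measure.map_map hW (measurable_fst.comp measurable_fst)]
    rfl
  let Y : (T₁ × T₂) × (ι → ℝ) → ι → ℝ := fun p =>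
    hd • x₂ (V p.1) p.1.2 + hc • x₁ (V p.1) p.1.1 + p.2
  have hY : Measurable Y :=
    (((hX₂.const_smul hd).add (hX₁.const_smul hc)).comp measurable_fst).add measurable_snd
  -- the residuals
  have hU : ∀ k, MemLp (fun t : T₁ × T₂ =>
      (hd - a * hc) * x₁ (V t) t.1 k - a * hd * x₂ (V t) t.2 k) 2 (τ₁.prod τ₂) := fun k =>
    ((hL₁ k).const_mul _).sub ((hL₂ k).const_mul _)
  -- The residual hd x₁ - a y₂ splits into a combination of the inputs and the independent noise -a
  -- z₂, which contributes a² to the second moment.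
  have eU : ∀ k, (fun p : (T₁ × T₂) × (ι → ℝ) =>
      (hd • x₁ (V p.1) p.1.1) k - a * Y p k) = fun p =>
      ((hd - a * hc) * x₁ (V p.1) p.1.1 k - a * hd * x₂ (V p.1) p.1.2 k) + (-a) * p.2 k := by
    intro k
    ext p
    simp only [Y, Pi.add_apply, Pi.smul_apply, smul_eq_mul]
    ring
  have hR : ∀ k, MemLp (fun p : (T₁ × T₂) × (ι → ℝ) =>
      (hd • x₁ (V p.1) p.1.1) k - a * Y p k) 2 μ := fun k => by
    rw [eU k]; exact memLp_add_mul_gaussian (hU k) (-a) k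
  have hR2 : ∀ k, ∫ p, ((hd • x₁ (V p.1) p.1.1) k - a * Y p k) ^ 2 ∂μ =
      ∫ t, ((hd - a * hc) * x₁ (V t) t.1 k - a * hd * x₂ (V t) t.2 k) ^ 2 ∂τ₁.prod τ₂ + a ^ 2 := by
    intro k
    have h1 := integral_sq_add_mul_gaussian (hU k) (-a) k
    rw [neg_sq] at h1
    rw [← h1]
    exact integral_congr_ae (ae_of_all _ fun p => by
      simp only
      rw [← congrFun (eU k) p])
  have hLLR : ∫ p : ((T₁ × T₂) × (ι → ℝ)) × (ι → ℝ),
      ∑ k, gaussianLLR σ ((hd • x₁ (V p.1.1) p.1.1.1) k) (a * Y p.1 k) (p.2 k) ∂μ.prod γ ≤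
      Fintype.card ι * Real.log σ := by
    rw [integral_finsetSum _ fun k _ => (integral_gaussianLLR (hR k) σ k).1]
    simp_rw [fun k => (integral_gaussianLLR (hR k) σ k).2, hR2]
    rw [Finset.sum_sub_distrib, Finset.sum_add_distrib, ← Finset.sum_div, Finset.sum_add_distrib,
      Finset.sum_add_distrib]
    simp only [Finset.sum_const, Finset.card_univ, nsmul_eq_mul]
    have h2 : 0 < 2 * σ ^ 2 := by positivity
    -- By `hmse`, the residual and z₁ together have total second moment at most |ι|σ², so this term
    -- is absorbed by the -1/2 per coordinate.
    have h3 : (∑ k, ∫ t, ((hd - a * hc) * x₁ (V t) t.1 k - a * hd * x₂ (V t) t.2 k) ^ 2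
        ∂τ₁.prod τ₂ + Fintype.card ι * a ^ 2 + Fintype.card ι * 1) / (2 * σ ^ 2) ≤
        Fintype.card ι * (1 / 2) := by
      rw [div_le_iff₀ h2]
      linarith
    linarith
  have key := log_card_mul_integral_le (μ := μ) hM hWm (hV.comp measurable_fst)
    ((hX₁.const_smul hd).comp measurable_fst) hY hWmap
    (q := softDecoder τ₂ B D (fun v t => hc • x₂ v t))
    (fun w v => measurable_softDecoder hD (fun v => (hx₂ v).const_smul hc) w v)
    (fun w v s => softDecoder_nonneg ..)
    (fun v s => sum_softDecoder_le hD (fun v => (hx₂ v).const_smul hc) v s) hfin (a := a) hσ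
    (integrable_finsetSum _ fun k _ => (integral_gaussianLLR (hR k) σ k).1)
  have hsucc := measureReal_success_eq_integral_softDecoder (τ₁ := τ₁) (τ₂ := τ₂) hW hB hD
    (fun v => (hx₁ v).const_smul hd) (fun v => (hx₂ v).const_smul hc) hV hVrect γ
  -- The other receiver's noise plays no role in decoding and is integrated out.
  have hπ : MeasurePreserving (Prod.map Prod.fst id : ((T₁ × T₂) × (ι → ℝ)) × (ι → ℝ) → _)
      (μ.prod γ) ((τ₁.prod τ₂).prod γ) := measurePreserving_fst.prod (MeasurePreserving.id γ)
  have hS : Measurable fun p : (T₁ × T₂) × (ι → ℝ) => hd • x₁ (V p.1) p.1.1 + p.2 :=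
    ((hX₁.const_smul hd).comp measurable_fst).add measurable_snd
  have hqm := measurable_softDecoder_comp (τ₂ := τ₂) (B := B) hD
    (fun v => (hx₂ v).const_smul hc) hWm (hV.comp measurable_fst) hS
  have hset : MeasurableSet {p : (T₁ × T₂) × (ι → ℝ) |
      D (hd • x₁ (V p.1) p.1.1 + p.2 + hc • x₂ (V p.1) p.1.2) = W p.1.1} :=
    measurableSet_eq_fun (hD.comp (hS.add ((hX₂.const_smul hc).comp measurable_fst))) hWm
  have hpre := hπ.measureReal_preimage hset.nullMeasurableSet
  have hint := integral_map (μ := μ.prod γ) hπ.measurable.aemeasurable hqm.aestronglyMeasurable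
  rw [hπ.map_eq] at hint
  have hfinal := hpre.trans (hsucc.trans hint)
  calc _ = _ := congrArg _ hfinal
    _ ≤ _ := key
    _ ≤ _ := add_le_add le_rfl hLLR

/-! ### From a code to two independent transmitters -/

lemma measurePreserving_prod_assoc_symm {α β γ : Type*} [MeasurableSpace α] [MeasurableSpace β]
    [MeasurableSpace γ] (μ : Measure α) (ν : Measure β) (ρ : Measure γ) [IsProbabilityMeasure μ]
    [IsProbabilityMeasure ν] [IsProbabilityMeasure ρ] :
    MeasurePreserving (fun p : α × β × γ => ((p.1, p.2.1), p.2.2)) (μ.prod (ν.prod ρ))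
      ((μ.prod ν).prod ρ) :=
  (measurePreserving_prodAssoc μ ν ρ).symm MeasurableEquiv.prodAssoc

lemma measurePreserving_prod_prod_prod_comm {α β γ δ : Type*} [MeasurableSpace α]
    [MeasurableSpace β] [MeasurableSpace γ] [MeasurableSpace δ] (μ : Measure α) (ν : Measure β)
    (ρ : Measure γ) (θ : Measure δ) [IsProbabilityMeasure μ] [IsProbabilityMeasure ν]
    [IsProbabilityMeasure ρ] [IsProbabilityMeasure θ] :
    MeasurePreserving (fun p : (α × β) × γ × δ => ((p.1.1, p.2.1), (p.1.2, p.2.2)))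
      ((μ.prod ν).prod (ρ.prod θ)) ((μ.prod ρ).prod (ν.prod θ)) := by
  have h1 := measurePreserving_prodAssoc μ ν (ρ.prod θ)
  have h2 := measurePreserving_prod_assoc_symm ν ρ θ
  have h3 : MeasurePreserving (Prod.swap : β × γ → γ × β) (ν.prod ρ) (ρ.prod ν) :=
    Measure.measurePreserving_swap
  have h4 := measurePreserving_prodAssoc ρ ν θ
  have h5 := measurePreserving_prod_assoc_symm μ ρ (ν.prod θ)
  exact h5.comp (((MeasurePreserving.id μ).prod
    (h4.comp ((h3.prod (MeasurePreserving.id θ)).comp h2))).comp h1)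

namespace ICCode

variable {N : ℕ} (c : ICCode N)

/-- The message and the local randomness of transmitter `i`. -/
abbrev User (i : Fin 2) : Type := Fin (c.numMsg i) × c.Rand i

/-- The joint law of the message and the local randomness of transmitter `i`. -/
noncomputable def userLaw (i : Fin 2) : Measure (c.User i) :=
  (uniformOn Set.univ).prod (c.randLaw i)

/-- All the cooperative symbols of a block. -/
abbrev CoopHist : Type := ∀ (i : Fin 2) (k : Fin N), Fin (c.coopCard i k)

/-- The data of transmitter `i` which are compatible with the cooperative symbols `v`. -/
def compatible (i : Fin 2) (v : c.CoopHist) : Set (c.User i) :=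
  {t | ∀ k, c.coop i k t.1 t.2 (fun l => v i.rev l.1) = v i k}

/-- The input block of transmitter `i` when the cooperative symbols are `v`. -/
def userInput (i : Fin 2) (v : c.CoopHist) (t : c.User i) : Fin N → ℝ :=
  fun k => c.enc i k t.1 t.2 (fun l => v i.rev l.1)

/-- A history occurs exactly when each transmitter, fed the other's symbols in it, replies with its
own. Strong induction on time works because replies use strictly earlier symbols. Hence each history
is a rectangle in the data of the two transmitters, which makes them conditionally independent given
it. -/
lemma coopSymbol_eq_iff (ω : c.Sample) (v : c.CoopHist) :
    c.coopSymbol ω = v ↔ ∀ i, (ω.1 i, ω.2.1 i) ∈ c.compatible i v := by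
  constructor
  · rintro rfl i k
    rw [coopSymbol]
  · intro h
    have key : ∀ n : ℕ, ∀ k : Fin N, k.1 = n → ∀ i, c.coopSymbol ω i k = v i k := by
      intro n
      induction n using Nat.strong_induction_on with
      | _ n ih =>
        intro k hk i
        rw [coopSymbol, ← h i k]
        congr 1
        ext1 l
        exact ih l.1.1 (hk ▸ l.2) l.1 rfl i.rev
    ext i k
    rw [key k k rfl i]

instance instIsProbabilityMeasureUniformMsg (i : Fin 2) :
    IsProbabilityMeasure (uniformOn (Set.univ : Set (Fin (c.numMsg i)))) := by
  have : NeZero (c.numMsg i) := ⟨(c.numMsg_pos i).ne'⟩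
  exact isProbabilityMeasure_uniformOn Set.finite_univ Set.univ_nonempty

instance instIsProbabilityMeasureUserLaw (i : Fin 2) : IsProbabilityMeasure (c.userLaw i) := by
  unfold userLaw; infer_instance

instance instIsProbabilityMeasureProb : IsProbabilityMeasure c.prob := by
  unfold prob; infer_instance

/-- The sample space, arranged by users, with the noise of receiver `0` last. -/
def arrange (ω : c.Sample) :
    ((c.User 0 × c.User 1) × (Fin N → ℝ)) × (Fin N → ℝ) :=
  ((((ω.1 0, ω.2.1 0), (ω.1 1, ω.2.1 1)), ω.2.2 1), ω.2.2 0)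

lemma measurePreserving_arrange :
    MeasurePreserving c.arrange c.prob
      ((((c.userLaw 0).prod (c.userLaw 1)).prod (Measure.pi fun _ => gaussianReal 0 1)).prod
        (Measure.pi fun _ => gaussianReal 0 1)) := by
  let γ : Measure (Fin N → ℝ) := Measure.pi fun _ => gaussianReal 0 1
  have h1 := measurePreserving_piFinTwo
    (fun i : Fin 2 => uniformOn (Set.univ : Set (Fin (c.numMsg i))))
  have h2 := measurePreserving_piFinTwo c.randLaw
  have h3 : MeasurePreserving (MeasurableEquiv.piFinTwo fun _ => Fin N → ℝ)
      (Measure.pi fun _ : Fin 2 => γ) (γ.prod γ) :=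
    measurePreserving_piFinTwo (fun _ : Fin 2 => γ)
  have h4 := h1.prod (h2.prod h3)
  have h5 := measurePreserving_prod_assoc_symm
    ((uniformOn (Set.univ : Set (Fin (c.numMsg 0)))).prod
      (uniformOn (Set.univ : Set (Fin (c.numMsg 1)))))
    ((c.randLaw 0).prod (c.randLaw 1)) (γ.prod γ)
  have h6 := measurePreserving_prod_prod_prod_comm
    (uniformOn (Set.univ : Set (Fin (c.numMsg 0))))
    (uniformOn (Set.univ : Set (Fin (c.numMsg 1)))) (c.randLaw 0) (c.randLaw 1)
  have h7 : MeasurePreserving (Prod.swap : (Fin N → ℝ) × (Fin N → ℝ) → _) (γ.prod γ) (γ.prod γ) :=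
    Measure.measurePreserving_swap
  have h8 := measurePreserving_prod_assoc_symm ((c.userLaw 0).prod (c.userLaw 1)) γ γ
  exact h8.comp ((h6.prod h7).comp (h5.comp h4))

/-- A sample point with the given data of the transmitters and without noise. -/
def noiseless (t : c.User 0 × c.User 1) : c.Sample :=
  ((MeasurableEquiv.piFinTwo fun i => Fin (c.numMsg i)).symm (t.1.1, t.2.1),
    (MeasurableEquiv.piFinTwo c.Rand).symm (t.1.2, t.2.2), 0)

/-- The cooperative symbols as a function of the data of the transmitters. -/
def history (t : c.User 0 × c.User 1) : c.CoopHist := c.coopSymbol (c.noiseless t)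

lemma history_eq_iff (t₀ : c.User 0) (t₁ : c.User 1) (v : c.CoopHist) :
    c.history (t₀, t₁) = v ↔ t₀ ∈ c.compatible 0 v ∧ t₁ ∈ c.compatible 1 v := by
  rw [history, coopSymbol_eq_iff, Fin.forall_fin_two]
  rfl

lemma history_arrange (ω : c.Sample) : c.history (c.arrange ω).1.1 = c.coopSymbol ω := by
  rw [arrange, history_eq_iff]
  have := (c.coopSymbol_eq_iff ω _).1 rfl
  exact ⟨this 0, this 1⟩

lemma measurableSet_compatible (i : Fin 2) (v : c.CoopHist) :
    MeasurableSet (c.compatible i v) := by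
  have : c.compatible i v = ⋂ k, {t | c.coop i k t.1 t.2 (fun l => v i.rev l.1) = v i k} := by
    ext t; simp [compatible]
  rw [this]
  refine MeasurableSet.iInter fun k => ?_
  have h : Measurable fun t : c.User i => c.coop i k t.1 t.2 (fun l => v i.rev l.1) :=
    measurable_uncurry_of_finite (f := fun w r => c.coop i k w r (fun l => v i.rev l.1))
      fun w => c.measurable_coop i k w _
  exact h (measurableSet_singleton _)

lemma measurable_userInput (i : Fin 2) (v : c.CoopHist) : Measurable (c.userInput i v) :=
  measurable_pi_lambda _ fun k =>
    measurable_uncurry_of_finite (f := fun w r => c.enc i k w r (fun l => v i.rev l.1))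
      fun w => c.measurable_enc i k w _

lemma measurable_history : Measurable c.history := by
  refine measurable_to_countable' fun v => ?_
  have : c.history ⁻¹' {v} = c.compatible 0 v ×ˢ c.compatible 1 v := by
    ext t
    exact c.history_eq_iff t.1 t.2 v
  rw [this]
  exact (c.measurableSet_compatible 0 v).prod (c.measurableSet_compatible 1 v)

lemma measurable_userInput_history_zero :
    Measurable fun t : c.User 0 × c.User 1 => c.userInput 0 (c.history t) t.1 := by
  simpa only [Function.comp_def] using
    (measurable_uncurry_of_finite (c.measurable_userInput 0)).comp
      (c.measurable_history.prodMk measurable_fst)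

lemma measurable_userInput_history_one :
    Measurable fun t : c.User 0 × c.User 1 => c.userInput 1 (c.history t) t.2 := by
  simpa only [Function.comp_def] using
    (measurable_uncurry_of_finite (c.measurable_userInput 1)).comp
      (c.measurable_history.prodMk measurable_snd)

lemma input_zero_eq (k : Fin N) (ω : c.Sample) :
    c.input 0 k ω = c.userInput 0 (c.history (c.arrange ω).1.1) (c.arrange ω).1.1.1 k := by
  rw [history_arrange]; rfl

lemma input_one_eq (k : Fin N) (ω : c.Sample) :
    c.input 1 k ω = c.userInput 1 (c.history (c.arrange ω).1.1) (c.arrange ω).1.1.2 k := by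
  rw [history_arrange]; rfl

lemma measurable_input (i : Fin 2) (k : Fin N) : Measurable (c.input i k) := by
  have hΦ : Measurable fun ω => (c.arrange ω).1.1 :=
    measurable_fst.comp (measurable_fst.comp c.measurePreserving_arrange.measurable)
  have h0 : Measurable (c.input 0 k) := by
    rw [funext (c.input_zero_eq k)]
    exact ((measurable_pi_apply k).comp c.measurable_userInput_history_zero).comp hΦ
  have h1 : Measurable (c.input 1 k) := by
    rw [funext (c.input_one_eq k)]
    exact ((measurable_pi_apply k).comp c.measurable_userInput_history_one).comp hΦ
  exact (Fin.forall_fin_two (p := fun i => Measurable (c.input i k))).2 ⟨h0, h1⟩ i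

/-- The two links contribute N·CG bits each. A sample point exists, so no alphabet is empty and the
logarithms have positive arguments. -/
lemma log_card_coopHist_le {CG : ℝ} (h : c.CoopRateLE CG) :
    Real.log (Fintype.card c.CoopHist) ≤ 2 * (N * CG * Real.log 2) := by
  obtain ⟨ω⟩ : Nonempty c.Sample := nonempty_of_isProbabilityMeasure c.prob
  have hpos : ∀ i, (0 : ℝ) < ((∏ k, c.coopCard i k : ℕ) : ℝ) := fun i => by
    exact_mod_cast Finset.prod_pos fun k _ => (c.coopSymbol ω i k).pos
  have hlog : ∀ i, Real.log ((∏ k, c.coopCard i k : ℕ) : ℝ) ≤ N * CG * Real.log 2 := fun i => by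
    rw [← Real.log_rpow two_pos]
    exact Real.log_le_log (hpos i) (h i)
  have hcard : (Fintype.card c.CoopHist : ℝ) =
      ((∏ k, c.coopCard 0 k : ℕ) : ℝ) * ((∏ k, c.coopCard 1 k : ℕ) : ℝ) := by
    rw [Fintype.card_pi, Fin.prod_univ_two]
    simp [Fintype.card_pi]
  rw [hcard, Real.log_mul (hpos 0).ne' (hpos 1).ne']
  linarith [hlog 0, hlog 1]

/-- The secrecy bound for the message of transmitter `0` of a code. -/
theorem log_numMsg_mul_le {CG : ℝ} (hrate : c.CoopRateLE CG) (hd hc : ℝ)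
    (hL : ∀ i k, MemLp (c.input i k) 2 c.prob) (hfin : c.leakage hd hc 0 ≠ ⊤) {a σ : ℝ}
    (hσ : 0 < σ)
    (hmse : ∑ k, ∫ ω, ((hd - a * hc) * c.input 0 k ω - a * hd * c.input 1 k ω) ^ 2 ∂c.prob ≤
      N * (σ ^ 2 - 1 - a ^ 2)) :
    Real.log (c.numMsg 0) * (1 - c.errorProb hd hc 0) ≤
      (c.leakage hd hc 0).toReal + 1 + 2 * (N * CG * Real.log 2) + N * Real.log σ := by
  let γ : Measure (Fin N → ℝ) := Measure.pi fun _ => gaussianReal 0 1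
  have hΦ := c.measurePreserving_arrange
  have hΦ₁ : MeasurePreserving (fun ω => (c.arrange ω).1) c.prob
      (((c.userLaw 0).prod (c.userLaw 1)).prod γ) := measurePreserving_fst.comp hΦ
  have hΦ₀ : MeasurePreserving (fun ω => (c.arrange ω).1.1) c.prob
      ((c.userLaw 0).prod (c.userLaw 1)) := measurePreserving_fst.comp hΦ₁
  have hX₀ := c.measurable_userInput_history_zero
  have hX₁ := c.measurable_userInput_history_one
  have hm₀ : ∀ k, Measurable fun t : c.User 0 × c.User 1 =>
      c.userInput 0 (c.history t) t.1 k := fun k => (measurable_pi_apply k).comp hX₀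
  have hm₁ : ∀ k, Measurable fun t : c.User 0 × c.User 1 =>
      c.userInput 1 (c.history t) t.2 k := fun k => (measurable_pi_apply k).comp hX₁
  have hL₀ : ∀ k, MemLp (fun t : c.User 0 × c.User 1 => c.userInput 0 (c.history t) t.1 k) 2
      ((c.userLaw 0).prod (c.userLaw 1)) := fun k => by
    rw [← hΦ₀.map_eq, memLp_map_measure_iff (hm₀ k).aestronglyMeasurable hΦ₀.measurable.aemeasurable]
    exact (hL 0 k).ae_eq (ae_of_all _ fun ω => c.input_zero_eq k ω)
  have hL₁ : ∀ k, MemLp (fun t : c.User 0 × c.User 1 => c.userInput 1 (c.history t) t.2 k) 2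
      ((c.userLaw 0).prod (c.userLaw 1)) := fun k => by
    rw [← hΦ₀.map_eq, memLp_map_measure_iff (hm₁ k).aestronglyMeasurable hΦ₀.measurable.aemeasurable]
    exact (hL 1 k).ae_eq (ae_of_all _ fun ω => c.input_one_eq k ω)
  have hout : ∀ ω, c.output hd hc 1 ω =
      hd • c.userInput 1 (c.history (c.arrange ω).1.1) (c.arrange ω).1.1.2 +
        hc • c.userInput 0 (c.history (c.arrange ω).1.1) (c.arrange ω).1.1.1 +
          (c.arrange ω).1.2 := fun ω => by
    ext k
    simp only [output, Pi.add_apply, Pi.smul_apply, smul_eq_mul, ← input_zero_eq, ← input_one_eq]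
    rfl
  have hW : Measurable (Prod.fst : c.User 0 → Fin (c.numMsg 0)) := measurable_fst
  have hY : Measurable fun p : (c.User 0 × c.User 1) × (Fin N → ℝ) =>
      hd • c.userInput 1 (c.history p.1) p.1.2 + hc • c.userInput 0 (c.history p.1) p.1.1 + p.2 :=
    (((hX₁.const_smul hd).add (hX₀.const_smul hc)).comp measurable_fst).add measurable_snd
  have hWp : Measurable fun p : (c.User 0 × c.User 1) × (Fin N → ℝ) => p.1.1.1 :=
    measurable_fst.comp (measurable_fst.comp measurable_fst)
  have hleak : c.leakage hd hc 0 = mutualInfo (((c.userLaw 0).prod (c.userLaw 1)).prod γ)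
      (fun p => p.1.1.1) (fun p => hd • c.userInput 1 (c.history p.1) p.1.2 +
        hc • c.userInput 0 (c.history p.1) p.1.1 + p.2) := by
    rw [mutualInfo, ← hΦ₁.map_eq, Measure.map_map (hWp.prodMk hY) hΦ₁.measurable,
      Measure.map_map hWp hΦ₁.measurable, Measure.map_map hY hΦ₁.measurable]
    have e : c.output hd hc 1 = (fun p : (c.User 0 × c.User 1) × (Fin N → ℝ) =>
      hd • c.userInput 1 (c.history p.1) p.1.2 + hc • c.userInput 0 (c.history p.1) p.1.1 + p.2) ∘
        fun ω => (c.arrange ω).1 := funext hout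
    rw [leakage, show Fin.rev (0 : Fin 2) = 1 from rfl, e]
    rfl
  have hmse' : ∑ k, ∫ t, ((hd - a * hc) * c.userInput 0 (c.history t) t.1 k -
      a * hd * c.userInput 1 (c.history t) t.2 k) ^ 2 ∂(c.userLaw 0).prod (c.userLaw 1) ≤
      Fintype.card (Fin N) * (σ ^ 2 - 1 - a ^ 2) := by
    rw [Fintype.card_fin]
    refine le_trans (le_of_eq (Finset.sum_congr rfl fun k _ => ?_)) hmse
    rw [← hΦ₀.map_eq, integral_map hΦ₀.measurable.aemeasurable
      (Measurable.aestronglyMeasurable (by fun_prop))]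
    simp_rw [input_zero_eq, input_one_eq]
  have hunif : (c.userLaw 0).map Prod.fst = uniformOn Set.univ := measurePreserving_fst.map_eq
  have key := log_card_mul_success_le (c.numMsg_pos 0) hW hunif
    (c.measurableSet_compatible 1) (c.measurable_dec 0) (c.measurable_userInput 0)
    (c.measurable_userInput 1) c.measurable_history c.history_eq_iff hL₀ hL₁ hd hc
    (hleak ▸ hfin) hσ hmse'
  have hset : MeasurableSet {p : ((c.User 0 × c.User 1) × (Fin N → ℝ)) × (Fin N → ℝ) |
      c.dec 0 (hd • c.userInput 0 (c.history p.1.1) p.1.1.1 + p.2 +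
        hc • c.userInput 1 (c.history p.1.1) p.1.1.2) = p.1.1.1.1} := by
    refine measurableSet_eq_fun ((c.measurable_dec 0).comp ?_) (hWp.comp measurable_fst)
    have h0 : Measurable fun p : ((c.User 0 × c.User 1) × (Fin N → ℝ)) × (Fin N → ℝ) => p.1.1 :=
      measurable_fst.comp measurable_fst
    exact (((hX₀.const_smul hd).comp h0).add measurable_snd).add ((hX₁.const_smul hc).comp h0)
  have hsucc := hΦ.measureReal_preimage hset.nullMeasurableSet
  have herr : c.errorProb hd hc 0 = 1 - c.prob.real (c.arrange ⁻¹'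
      {p : ((c.User 0 × c.User 1) × (Fin N → ℝ)) × (Fin N → ℝ) |
      c.dec 0 (hd • c.userInput 0 (c.history p.1.1) p.1.1.1 + p.2 +
        hc • c.userInput 1 (c.history p.1.1) p.1.1.2) = p.1.1.1.1}) := by
    rw [← probReal_compl_eq_one_sub (hΦ.measurable hset), errorProb]
    congr 1
    ext ω
    simp only [Set.mem_ofPred_eq, Set.mem_compl_iff, Set.mem_preimage, ne_eq]
    have e : c.output hd hc 0 ω =
        hd • c.userInput 0 (c.history (c.arrange ω).1.1) (c.arrange ω).1.1.1 + (c.arrange ω).2 +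
        hc • c.userInput 1 (c.history (c.arrange ω).1.1) (c.arrange ω).1.1.2 := by
      ext k
      simp only [output, Pi.add_apply, Pi.smul_apply, smul_eq_mul, ← input_zero_eq, ← input_one_eq]
      exact add_right_comm _ _ _
    rw [e]
    rfl
  rw [herr, sub_sub_cancel, hsucc, hleak]
  have hcard := c.log_card_coopHist_le hrate
  rw [Fintype.card_fin] at key
  exact key.trans (by gcongr)

end ICCode

/-! ### Power constraint and correlation of the inputs -/

lemma memLp_two_of_lintegral_sq_ne_top {Ω : Type*} [MeasurableSpace Ω] {μ : Measure Ω} {x : Ω → ℝ}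
    (hx : Measurable x) (h : ∫⁻ ω, ENNReal.ofReal (x ω ^ 2) ∂μ ≠ ⊤) : MemLp x 2 μ := by
  rw [memLp_two_iff_integrable_sq hx.aestronglyMeasurable]
  refine ⟨(hx.pow_const 2).aestronglyMeasurable, ?_⟩
  rw [hasFiniteIntegral_iff_ofReal (ae_of_all _ fun ω => sq_nonneg (x ω))]
  exact lt_top_iff_ne_top.2 h

namespace ICCode

variable {N : ℕ} {c : ICCode N}

lemma PowerLE.memLp_input {P : ℝ} (h : c.PowerLE P) (i : Fin 2) (k : Fin N) :
    MemLp (c.input i k) 2 c.prob := by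
  refine memLp_two_of_lintegral_sq_ne_top (c.measurable_input i k) (ne_top_of_le_ne_top
    ENNReal.ofReal_ne_top (le_trans ?_ (h i)))
  exact Finset.single_le_sum
    (f := fun k => ∫⁻ ω, ENNReal.ofReal (c.input i k ω ^ 2) ∂c.prob)
    (fun _ _ => zero_le) (Finset.mem_univ k)

lemma PowerLE.sum_integral_sq_le {P : ℝ} (hP : 0 ≤ P) (h : c.PowerLE P) (i : Fin 2) :
    ∑ k, ∫ ω, c.input i k ω ^ 2 ∂c.prob ≤ N * P := by
  have e : ∀ k, ENNReal.ofReal (∫ ω, c.input i k ω ^ 2 ∂c.prob) =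
      ∫⁻ ω, ENNReal.ofReal (c.input i k ω ^ 2) ∂c.prob := fun k =>
    ofReal_integral_eq_lintegral_ofReal (h.memLp_input i k).integrable_sq
      (ae_of_all _ fun ω => sq_nonneg _)
  have h1 := h i
  simp_rw [← e] at h1
  rw [← ENNReal.ofReal_sum_of_nonneg fun k _ => integral_nonneg fun ω => sq_nonneg _] at h1
  exact (ENNReal.ofReal_le_ofReal_iff (by positivity)).1 h1

/-- The second moments of linear combinations of the two inputs are controlled by the power and by
the time average `C` of the correlations. -/
lemma PowerLE.exists_correlation {P : ℝ} (hP : 0 ≤ P) (h : c.PowerLE P) (hN : 0 < N) :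
    ∃ C : ℝ, |C| ≤ P ∧ ∀ α β : ℝ,
      ∑ k, ∫ ω, (α * c.input 0 k ω - β * c.input 1 k ω) ^ 2 ∂c.prob ≤
        N * (α ^ 2 * P - 2 * α * β * C + β ^ 2 * P) := by
  have hN' : (0 : ℝ) < N := by exact_mod_cast hN
  set S := ∑ k, ∫ ω, c.input 0 k ω * c.input 1 k ω ∂c.prob
  have expand : ∀ α β : ℝ, ∑ k, ∫ ω, (α * c.input 0 k ω - β * c.input 1 k ω) ^ 2 ∂c.prob =
      α ^ 2 * ∑ k, ∫ ω, c.input 0 k ω ^ 2 ∂c.prob - 2 * α * β * S +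
        β ^ 2 * ∑ k, ∫ ω, c.input 1 k ω ^ 2 ∂c.prob := by
    intro α β
    simp only [S, Finset.mul_sum]
    rw [← Finset.sum_sub_distrib, ← Finset.sum_add_distrib]
    refine Finset.sum_congr rfl fun k _ => ?_
    have i0 := (h.memLp_input 0 k).integrable_sq
    have i1 := (h.memLp_input 1 k).integrable_sq
    have i01 : Integrable (fun ω => c.input 0 k ω * c.input 1 k ω) c.prob :=
      (h.memLp_input 0 k).integrable_mul (h.memLp_input 1 k)
    have e : ∀ ω, (α * c.input 0 k ω - β * c.input 1 k ω) ^ 2 =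
        α ^ 2 * c.input 0 k ω ^ 2 - 2 * α * β * (c.input 0 k ω * c.input 1 k ω) +
          β ^ 2 * c.input 1 k ω ^ 2 := fun ω => by ring
    simp_rw [e]
    rw [integral_add (by exact (i0.const_mul _).sub (i01.const_mul _)) (i1.const_mul _),
      integral_sub (i0.const_mul _) (i01.const_mul _), integral_const_mul, integral_const_mul,
      integral_const_mul]
  have h0 := h.sum_integral_sq_le hP 0
  have h1 := h.sum_integral_sq_le hP 1
  have nonneg : ∀ α β : ℝ,
      0 ≤ ∑ k, ∫ ω, (α * c.input 0 k ω - β * c.input 1 k ω) ^ 2 ∂c.prob := fun α β =>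
    Finset.sum_nonneg fun k _ => integral_nonneg fun ω => sq_nonneg _
  refine ⟨S / N, ?_, fun α β => ?_⟩
  -- The second moments of x₁ - x₂ and x₁ + x₂ are nonnegative, which gives |S| ≤ N·P.
  · have n1 := nonneg 1 1
    have n2 := nonneg 1 (-1)
    rw [expand] at n1 n2
    rw [abs_le, le_div_iff₀ hN', div_le_iff₀ hN']
    constructor <;> linarith
  · have e : (N : ℝ) * (α ^ 2 * P - 2 * α * β * (S / N) + β ^ 2 * P) =
        α ^ 2 * (N * P) - 2 * α * β * S + β ^ 2 * (N * P) := by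
      field_simp
    rw [expand, e]
    have := mul_le_mul_of_nonneg_left h0 (sq_nonneg α)
    have := mul_le_mul_of_nonneg_left h1 (sq_nonneg β)
    linarith

end ICCode

/-! ### Linear estimation and the maximum over ρ -/

/-- The residual variance of the linear estimator of `hd x₁ + z₁` from `hd x₂ + hc x₁ + z₂`, for
inputs of power `P` and correlation `C`. -/
lemma exists_linear_estimator {hd hc P C : ℝ} (hP : 0 ≤ P) (hC : |C| ≤ P) :
    ∃ a v : ℝ, 1 ≤ v ∧
      (hd - a * hc) ^ 2 * P - 2 * (hd - a * hc) * (a * hd) * C + (a * hd) ^ 2 * P =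
        v - 1 - a ^ 2 ∧
      ∃ ρ : ℝ, |ρ| ≤ 1 ∧ v = 1 + (hd ^ 2 * P + (hd ^ 2 * P) ^ 2 * (1 - ρ ^ 2)) /
        (1 + hd ^ 2 * P + hc ^ 2 * P + 2 * ρ * Real.sqrt (hd ^ 2 * P * (hc ^ 2 * P))) := by
  obtain ⟨hC1, hC2⟩ := abs_le.1 hC
  set A := 1 + hd ^ 2 * P + hc ^ 2 * P + 2 * (hd * hc * C) with hA
  -- 2(A - 1) = (hd + hc)²(P + C) + (hd - hc)²(P - C).
  have hA1 : 1 ≤ A := by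
    nlinarith [mul_nonneg (sq_nonneg (hd + hc)) (by linarith : 0 ≤ P + C),
      mul_nonneg (sq_nonneg (hd - hc)) (by linarith : 0 ≤ P - C)]
  have hA0 : A ≠ 0 := by linarith
  have hCP : C ^ 2 ≤ P ^ 2 := sq_le_sq' hC1 hC2
  have hsqrt : Real.sqrt (hd ^ 2 * P * (hc ^ 2 * P)) = |hd * hc| * P := by
    rw [show hd ^ 2 * P * (hc ^ 2 * P) = (hd * hc * P) ^ 2 by ring, Real.sqrt_sq_eq_abs, abs_mul,
      abs_of_nonneg hP]
  -- The square root in the bound forgets the sign of hd·hc, so ρ is C / P carrying that sign. If P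
  -- = 0 then C = 0 and ρ = 0 serves.
  obtain ⟨ρ, hρ, hρC, hρ2⟩ : ∃ ρ : ℝ, |ρ| ≤ 1 ∧ ρ * (|hd * hc| * P) = hd * hc * C ∧
      P ^ 2 * ρ ^ 2 = C ^ 2 := by
    rcases hP.eq_or_lt with rfl | hP'
    · have : C = 0 := by linarith
      exact ⟨0, by simp, by simp [this], by simp [this]⟩
    have hle : |C / P| ≤ 1 := by rw [abs_div, abs_of_pos hP', div_le_one hP']; exact hC
    rcases le_total 0 (hd * hc) with hs | hs
    · refine ⟨C / P, hle, ?_, by field_simp⟩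
      rw [abs_of_nonneg hs]; field_simp
    · refine ⟨-(C / P), by rwa [abs_neg], ?_, by field_simp⟩
      rw [abs_of_nonpos hs]; field_simp
  have hden : 1 + hd ^ 2 * P + hc ^ 2 * P +
      2 * ρ * Real.sqrt (hd ^ 2 * P * (hc ^ 2 * P)) = A := by
    rw [hsqrt, hA, ← hρC]; ring
  have hnum : (hd ^ 2 * P) ^ 2 * (1 - ρ ^ 2) = hd ^ 4 * (P ^ 2 - C ^ 2) := by
    rw [← hρ2]; ring
  -- With b the covariance of hd x₁ and y₂, and A the second moment of y₂, the optimal coefficient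
  -- is b / A, and v = 1 + hd²P - b² / A.
  refine ⟨(hd * hc * P + hd ^ 2 * C) / A, 1 + (hd ^ 2 * P + hd ^ 4 * (P ^ 2 - C ^ 2)) / A, ?_, ?_,
    ρ, hρ, by rw [hden, hnum]⟩
  · have : 0 ≤ (hd ^ 2 * P + hd ^ 4 * (P ^ 2 - C ^ 2)) / A :=
      div_nonneg (add_nonneg (by positivity) (mul_nonneg (by positivity) (by linarith)))
        (by linarith)
    linarith
  · set b := hd * hc * P + hd ^ 2 * C with hb
    have h1 : ∀ a : ℝ, (hd - a * hc) ^ 2 * P - 2 * (hd - a * hc) * (a * hd) * C +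
        (a * hd) ^ 2 * P = hd ^ 2 * P - 2 * a * b + a ^ 2 * A - a ^ 2 := fun a => by
      rw [hb, hA]; ring
    rw [h1]
    have h2 : hd ^ 2 * P + hd ^ 4 * (P ^ 2 - C ^ 2) = hd ^ 2 * P * A - b ^ 2 := by
      rw [hb, hA]; ring
    rw [h2]
    field_simp
    ring

/-- The right-hand side of the outer bound attains its maximum. -/
lemma exists_isGreatest_outerBound {CG S I : ℝ} (hS : 0 ≤ S) (hI : 0 ≤ I) :
    ∃ B : ℝ, IsGreatest ((fun ρ : ℝ => 2 * CG + 1 / 2 * Real.logb 2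
      (1 + (S + S ^ 2 * (1 - ρ ^ 2)) / (1 + S + I + 2 * ρ * Real.sqrt (S * I)))) ''
        {ρ : ℝ | |ρ| ≤ 1}) B := by
  have hset : {ρ : ℝ | |ρ| ≤ 1} = Set.Icc (-1) 1 := by
    ext ρ; simp [abs_le]
  rw [hset]
  -- This AM-GM bound keeps the denominator positive down to ρ = -1.
  have hsq : 2 * Real.sqrt (S * I) ≤ S + I := by
    rw [Real.sqrt_mul hS]
    nlinarith [sq_nonneg (Real.sqrt S - Real.sqrt I), Real.sq_sqrt hS, Real.sq_sqrt hI]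
  have hden : ∀ ρ ∈ Set.Icc (-1 : ℝ) 1, 0 < 1 + S + I + 2 * ρ * Real.sqrt (S * I) := by
    intro ρ hρ
    nlinarith [mul_nonneg (by linarith [hρ.1] : 0 ≤ 1 + ρ) (Real.sqrt_nonneg (S * I))]
  have harg : ∀ ρ ∈ Set.Icc (-1 : ℝ) 1,
      0 < 1 + (S + S ^ 2 * (1 - ρ ^ 2)) / (1 + S + I + 2 * ρ * Real.sqrt (S * I)) := by
    intro ρ hρ
    have h1 : 0 ≤ 1 - ρ ^ 2 := by nlinarith [hρ.1, hρ.2]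
    have h2 := div_nonneg (add_nonneg hS (mul_nonneg (sq_nonneg S) h1)) (hden ρ hρ).le
    linarith
  refine (isCompact_Icc.image_of_continuousOn ?_).exists_isGreatest
    ((Set.nonempty_Icc.2 (by norm_num)).image _)
  refine continuousOn_const.add (continuousOn_const.mul ?_)
  refine ContinuousOn.div_const (ContinuousOn.log ?_ fun ρ hρ => (harg ρ hρ).ne') _
  exact continuousOn_const.add (ContinuousOn.div (by fun_prop) (by fun_prop)
    fun ρ hρ => (hden ρ hρ).ne')

/-! ### Conclusion: long blocks and ε → 0 -/

theorem theorem8 (hd hc P CG SNR INR : ℝ) (hP : 0 ≤ P) (hCG : 0 ≤ CG)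
    (hSNR : SNR = hd ^ 2 * P) (hINR : INR = hc ^ 2 * P) :
    ∃ B : ℝ,
      IsGreatest
        ((fun ρ : ℝ => 2 * CG + 1 / 2 * Real.logb 2
          (1 + (SNR + SNR ^ 2 * (1 - ρ ^ 2)) /
            (1 + SNR + INR + 2 * ρ * Real.sqrt (SNR * INR)))) '' {ρ : ℝ | |ρ| ≤ 1}) B ∧
      ∀ R : ℝ, IsAchievableSymmSecrecyRate hd hc P CG R → R ≤ B := by
  obtain ⟨B, hB⟩ := exists_isGreatest_outerBound (CG := CG) (S := SNR) (I := INR)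
    (by rw [hSNR]; positivity) (by rw [hINR]; positivity)
  refine ⟨B, hB, fun R hR => ?_⟩
  have hlog2 : 0 < Real.log 2 := Real.log_pos one_lt_two
  have main : ∀ ε : ℝ, 0 < ε → ε < 1 →
      (R - ε) * (1 - ε) * Real.log 2 ≤ B * Real.log 2 + 2 * ε := by
    intro ε hε hε1
    -- Taking N ≥ 1/ε lets the additive 1 of the block bound count as N·ε, the same size as the
    -- leakage; together they give the 2ε.
    obtain ⟨N, ⟨c, hrate, hpow, hc0⟩, hNε⟩ :=
      ((hR ε hε).and (eventually_ge_atTop ⌈1 / ε⌉₊)).exists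
    obtain ⟨hRate, hErr, hLeak⟩ := hc0 0
    have hNε' : 1 / ε ≤ (N : ℝ) := (Nat.le_ceil _).trans (by exact_mod_cast hNε)
    have hN0 : (0 : ℝ) < N := lt_of_lt_of_le (by positivity) hNε'
    have hN1 : 1 ≤ N * ε := by rwa [div_le_iff₀ hε] at hNε'
    obtain ⟨C, hC, hmom⟩ := hpow.exists_correlation hP (by exact_mod_cast hN0)
    obtain ⟨a, v, hv, hmse, ρ, hρ, hvρ⟩ := exists_linear_estimator (hd := hd) (hc := hc) hP hC
    have hv0 : 0 < v := by linarith
    have hblock := c.log_numMsg_mul_le hrate hd hc hpow.memLp_input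
      (ne_top_of_le_ne_top ENNReal.ofReal_ne_top hLeak) (a := a) (σ := Real.sqrt v)
      (Real.sqrt_pos.2 hv0) (by
        rw [Real.sq_sqrt hv0.le, ← hmse]
        exact hmom (hd - a * hc) (a * hd))
    have hleak : (c.leakage hd hc 0).toReal ≤ N * ε :=
      ENNReal.toReal_le_of_le_ofReal (by positivity) hLeak
    have hBρ : 2 * CG + 1 / 2 * Real.logb 2 v ≤ B :=
      hB.2 ⟨ρ, hρ, by simp only [hvρ, hSNR, hINR]⟩
    have hlogv : Real.log v = Real.logb 2 v * Real.log 2 :=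
      (div_mul_cancel₀ _ hlog2.ne').symm
    have hlogM : (R - ε) * (N * Real.log 2) ≤ Real.log (c.numMsg 0) := by
      rw [le_div_iff₀ hN0, Real.logb, le_div_iff₀ hlog2] at hRate
      linarith
    have hM0 : 0 ≤ Real.log (c.numMsg 0) := Real.log_natCast_nonneg _
    rw [Real.log_sqrt hv0.le, hlogv] at hblock
    -- R - ε may be negative, so the rate bound is first multiplied by 1 - ε ≥ 0, and only then is
    -- the error bound multiplied by log M ≥ 0.
    have h1 : (R - ε) * (N * Real.log 2) * (1 - ε) ≤
        Real.log (c.numMsg 0) * (1 - c.errorProb hd hc 0) :=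
      (mul_le_mul_of_nonneg_right hlogM (by linarith)).trans
        (mul_le_mul_of_nonneg_left (by linarith) hM0)
    have h2 : N * Real.log 2 * (2 * CG + 1 / 2 * Real.logb 2 v) ≤ N * Real.log 2 * B :=
      mul_le_mul_of_nonneg_left hBρ (by positivity)
    refine le_of_mul_le_mul_left ?_ hN0
    linarith
  have htend : Tendsto (fun ε : ℝ => (R - ε) * (1 - ε) * Real.log 2 - 2 * ε)
      (nhdsWithin 0 (Set.Ioi 0)) (nhds (R * Real.log 2)) := by
    have hcont : Continuous fun ε : ℝ => (R - ε) * (1 - ε) * Real.log 2 - 2 * ε := by fun_prop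
    have := (hcont.tendsto 0).mono_left (nhdsWithin_le_nhds (s := Set.Ioi 0))
    simpa using this
  have hle : R * Real.log 2 ≤ B * Real.log 2 := by
    refine le_of_tendsto htend ?_
    filter_upwards [Ioo_mem_nhdsGT (zero_lt_one (α := ℝ))] with ε hε
    linarith [main ε hε.1 hε.2]
  exact le_of_mul_le_mul_right hle hlog2
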